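/- Let $p>1$ and $h\in(0,1)$, and let $a=a_h:[0,1]\to\{0,1\}$ be equal to $0$ on $(\frac{1-h}{2},\frac{1+h}{2})$ and to $1$ elsewhere. Consider, for $\lambda\in\mathbb R$, $$-u''=\lambda u+a(x)u^p\ \text{ in }(0,1),\qquad u(0)=u(1)=0. \tag{1}$$ A solution is a function $u\in C^1([0,1])$ that satisfies the boundary conditions and, except at the two jumps of $a$, the equation at each point of $(0,1)$; a positive solution is a solution $u\ge 0$, $u\not\equiv 0$; it is symmetric if $u(1-x)=u(x)$ for all $x\in[0,1]$. Let $\mathscr C_h^+$ (respectively $\mathscr C_{h,s}^+$) be the connected component containing $(\pi^2,0)$ of the closure in $\mathbb R\times C([0,1])$, with the sup norm on $C([0,1])$, of the set of pairs $(\lambda,u)$ such that $u$ is a positive (respectively symmetric positive) solution of (1). Theorem. $(\pi^2,0)$ lies in the closure of the set of pairs $(\lambda,u)$ with $u$ a symmetric positive solution of (1), so that $(\pi^2,0)\in\mathscr C_{h,s}^+$, and the projection of $\mathscr C_{h,s}^+$ to the $\lambda$-axis is $(-\infty,\pi^2]$. For every $\lambda<\pi^2$, problem (1) has a unique symmetric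 positive solution $u_\lambda$; put $u_{\pi^2}:=0$. Moreover: (a) for every $(\lambda,u)\in\mathscr C_{h,s}^+$, either $\lambda=\pi^2$ and $u=0$, or $\lambda<\pi^2$ and $u$ is the unique symmetric positive solution of (1); (b) for every $\sigma\in(-\infty,\pi^2]$, $\lim_{\lambda\to\sigma,\ \lambda<\pi^2}\|u_\lambda\|_\infty=0$ if and only if $\sigma=\pi^2$; (c) for every $\lambda_0<\pi^2$, the set $\{u_\lambda:\lambda\in[\lambda_0,\pi^2)\}$ is bounded in $C^1([0,1])$, while $\lim_{\lambda\to-\infty}\|u_\lambda\|_\infty=+\infty$; (d) the map $\lambda\mapsto u_\lambda$ is continuous from $(-\infty,\pi^2]$ to $C([0,1])$, and $\mathscr C_{h,s}^+=\{(\lambda,u_\lambda):\lambda\in(-\infty,\pi^2]\}$, which is thus a continuous curve. Finally, $\mathscr C_{h,s}^+\subseteq\mathscr C_h^+$. -/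

import Mathlib

open Set Filter Topology

noncomputable section

namespace MooreNehari

/-- The piecewise constant weight `a_h`: it vanishes on `((1-h)/2, (1+h)/2)` and equals `1`
elsewhere. -/
def weight (h x : ℝ) : ℝ :=
  open Classical in if x ∈ Ioo ((1 - h) / 2) ((1 + h) / 2) then 0 else 1

/-- The extension to `ℝ`, constant to the left of `0` and to the right of `1`, of a function
on `[0,1]`. It only serves to write derivatives; it is used on `[0,1]` alone. -/
def extendI (u : C(unitInterval, ℝ)) : ℝ → ℝ :=
  IccExtend (zero_le_one' ℝ) u

/-- The derivative of `u` on `[0,1]` (one-sided at the end points). -/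
def derivI (u : C(unitInterval, ℝ)) (x : ℝ) : ℝ :=
  derivWithin (extendI u) (Icc 0 1) x

/-- `u` solves `-u'' = lam * u + a_h(x) * u ^ p` in `(0,1)`, `u(0) = u(1) = 0`. As `a_h` jumps at
`(1-h)/2` and `(1+h)/2`, this means that `u` is of class `C¹` on `[0,1]`, with derivative `v`, and
that the equation holds at every point of `(0,1)` other than those two. (Equivalently:
`u'` is absolutely continuous and the equation holds almost everywhere.) -/
def IsSolution (p h lam : ℝ) (u : C(unitInterval, ℝ)) : Prop :=
  u 0 = 0 ∧ u 1 = 0 ∧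
    ∃ v : ℝ → ℝ,
      ContinuousOn v (Icc 0 1) ∧
      (∀ x ∈ Icc (0 : ℝ) 1, HasDerivWithinAt (extendI u) (v x) (Icc 0 1) x) ∧
      ∀ x ∈ Ioo (0 : ℝ) 1, x ≠ (1 - h) / 2 → x ≠ (1 + h) / 2 →
        HasDerivAt v (-(lam * extendI u x + weight h x * extendI u x ^ p)) x

/-- A positive solution is a non-negative solution that is not identically zero. -/
def IsPositiveSolution (p h lam : ℝ) (u : C(unitInterval, ℝ)) : Prop :=
  IsSolution p h lam u ∧ (∀ x, 0 ≤ u x) ∧ u ≠ 0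

/-- Positive solutions that are even about `x = 1/2`, i.e. `u (1 - x) = u x`. -/
def IsSymmetricPositiveSolution (p h lam : ℝ) (u : C(unitInterval, ℝ)) : Prop :=
  IsPositiveSolution p h lam u ∧ ∀ x, u (unitInterval.symm x) = u x

/-- The component of positive solutions emanating from `(π², 0)`: the connected component of
`(π², 0)` in the closure, in `ℝ × C([0,1])`, of the set of pairs `(lam, u)` with `u` a positive
solution. It is empty if `(π², 0)` is not in that closure. -/
def component (p h : ℝ) : Set (ℝ × C(unitInterval, ℝ)) :=
  connectedComponentIn
    (closure {q : ℝ × C(unitInterval, ℝ) | IsPositiveSolution p h q.1 q.2})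
    (Real.pi ^ 2, 0)

/-- The component of symmetric positive solutions emanating from `(π², 0)`: the connected
component of `(π², 0)` in the closure, in `ℝ × C([0,1])`, of the set of pairs `(lam, u)` with `u` a
symmetric positive solution. It is empty if `(π², 0)` is not in that closure. -/
def symmetricComponent (p h : ℝ) : Set (ℝ × C(unitInterval, ℝ)) :=
  connectedComponentIn
    (closure {q : ℝ × C(unitInterval, ℝ) | IsSymmetricPositiveSolution p h q.1 q.2})
    (Real.pi ^ 2, 0)

end MooreNehari

end

namespace MooreNehari

/-! Symmetry reduces the problem to shooting on the left outer interval `[0, a]`, `a = (1 - h) / 2`.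
In the gap the equation is linear, so a symmetric solution is there a multiple of `mode lam`. For
`lam < π²`, a trajectory with `u 0 = 0`, `u' 0 = s > 0` therefore extends to a symmetric positive
solution exactly when its Wronskian with `mode lam` vanishes at `a`, and everything rests on the
zeros of this function of `s`.

Replacing `u` by its positive part in the nonlinearity lets every shot live on all of `[0, a]`: past
a zero it is affine. A shot that has vanished has negative Wronskian
(`IsTraj.pos_or_modeWronskian_neg`), so the zeros of the Wronskian come from positive shots. For
`lam < π²` the Wronskian is positive for small `s`, because `mode lam 0 > 0`
(`IsShooting.eventually_modeWronskian_pos`), and negative for large `s`, by a Sturm comparison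
(`exists_modeWronskian_neg_of_lt`). Two positive shots with different slopes never have the same
logarithmic derivative at `a`; this follows from their mutual Wronskian and the energy identity
(`IsTraj.wronskian_neg`). So there is exactly one zero `σ lam`, with a change of sign, and `σ` is
continuous in `lam`. At `π²` the Wronskian is negative for every `s > 0`, which forces `σ` to tend
to `0`.

Gluing turns `σ` into a continuous map `U` on `(-∞, π²]`. Comparison with the first eigenfunction
excludes positive solutions for `lam ≥ π²` and gives `π² - lam ≤ ‖u‖ ^ (p - 1)`, hence the blow-up
at `-∞`. The symmetric positive solutions thus form the graph of `U` over `(-∞, π²)`; its closure is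
the graph over `(-∞, π²]`, which is connected and so is the whole component. -/

/-! ### Monotonicity off a finite set and a Grönwall estimate. -/

/-- Induction on the exceptional set: an exceptional point inside the interval cuts it in two, and
the hypothesis is applied to both halves, so the end points must remain quantified. -/
theorem antitoneOn_of_hasDerivAt_nonpos_off_finite {f f' : ℝ → ℝ} (S : Finset ℝ) :
    ∀ {α β : ℝ}, ContinuousOn f (Icc α β) →
      (∀ x ∈ Ioo α β, x ∉ S → HasDerivAt f (f' x) x) →
      (∀ x ∈ Ioo α β, x ∉ S → f' x ≤ 0) → AntitoneOn f (Icc α β) := by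
  induction S using Finset.induction_on with
  | empty =>
    intro α β hc hd hle
    refine antitoneOn_of_deriv_nonpos (convex_Icc α β) hc ?_ ?_
    · rw [interior_Icc]
      exact fun x hx => (hd x hx (by simp)).differentiableAt.differentiableWithinAt
    · rw [interior_Icc]
      intro x hx
      rw [(hd x hx (by simp)).deriv]
      exact hle x hx (by simp)
  | insert c S hcS ih =>
    intro α β hc hd hle
    by_cases hcm : c ∈ Ioo α β
    · have h1 : AntitoneOn f (Icc α c) := by
        refine ih (hc.mono (Icc_subset_Icc_right hcm.2.le)) ?_ ?_
        · intro x hx hxS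
          exact hd x ⟨hx.1, hx.2.trans hcm.2⟩ (by simp [hxS, hx.2.ne])
        · intro x hx hxS
          exact hle x ⟨hx.1, hx.2.trans hcm.2⟩ (by simp [hxS, hx.2.ne])
      have h2 : AntitoneOn f (Icc c β) := by
        refine ih (hc.mono (Icc_subset_Icc_left hcm.1.le)) ?_ ?_
        · intro x hx hxS
          exact hd x ⟨hcm.1.trans hx.1, hx.2⟩ (by simp [hxS, hx.1.ne'])
        · intro x hx hxS
          exact hle x ⟨hcm.1.trans hx.1, hx.2⟩ (by simp [hxS, hx.1.ne'])
      rw [← Icc_union_Icc_eq_Icc hcm.1.le hcm.2.le]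
      exact h1.union_right h2 (isGreatest_Icc hcm.1.le) (isLeast_Icc hcm.2.le)
    · refine ih hc ?_ ?_
      · intro x hx hxS
        refine hd x hx ?_
        simp only [Finset.mem_insert, not_or]
        exact ⟨fun h => hcm (h ▸ hx), hxS⟩
      · intro x hx hxS
        refine hle x hx ?_
        simp only [Finset.mem_insert, not_or]
        exact ⟨fun h => hcm (h ▸ hx), hxS⟩

theorem monotoneOn_of_hasDerivAt_nonneg_off_finite {f f' : ℝ → ℝ} (S : Finset ℝ) {α β : ℝ}
    (hc : ContinuousOn f (Icc α β)) (hd : ∀ x ∈ Ioo α β, x ∉ S → HasDerivAt f (f' x) x)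
    (hle : ∀ x ∈ Ioo α β, x ∉ S → 0 ≤ f' x) : MonotoneOn f (Icc α β) := by
  have h := antitoneOn_of_hasDerivAt_nonpos_off_finite (f := fun x => -f x)
    (f' := fun x => -f' x) S hc.neg (fun x hx hxS => (hd x hx hxS).fun_neg)
    (fun x hx hxS => by simpa using hle x hx hxS)
  intro x hx y hy hxy
  simpa using h hx hy hxy

/-- Grönwall estimate for the difference of two trajectories of second order equations. -/
theorem sq_add_sq_sub_le {u₁ v₁ g₁ u₂ v₂ g₂ : ℝ → ℝ} (S : Finset ℝ) {α β L D : ℝ} (hL : 0 ≤ L)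
    (hu₁ : ContinuousOn u₁ (Icc α β)) (hv₁ : ContinuousOn v₁ (Icc α β))
    (hu₂ : ContinuousOn u₂ (Icc α β)) (hv₂ : ContinuousOn v₂ (Icc α β))
    (du₁ : ∀ x ∈ Ioo α β, HasDerivAt u₁ (v₁ x) x)
    (du₂ : ∀ x ∈ Ioo α β, HasDerivAt u₂ (v₂ x) x)
    (dv₁ : ∀ x ∈ Ioo α β, x ∉ S → HasDerivAt v₁ (g₁ x) x)
    (dv₂ : ∀ x ∈ Ioo α β, x ∉ S → HasDerivAt v₂ (g₂ x) x)
    (hg : ∀ x ∈ Ioo α β, x ∉ S → |g₁ x - g₂ x| ≤ L * |u₁ x - u₂ x| + D)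
    {x : ℝ} (hx : x ∈ Icc α β) :
    (u₁ x - u₂ x) ^ 2 + (v₁ x - v₂ x) ^ 2 ≤
      ((u₁ α - u₂ α) ^ 2 + (v₁ α - v₂ α) ^ 2 + D ^ 2) * Real.exp ((2 + L) * (x - α)) := by
  set K := 2 + L with hK
  -- Keeping `D ^ 2` inside the functional absorbs the inhomogeneous term: `2 * |z| * D ≤ z ^ 2 + D
  -- ^ 2`, and the rate `2 + L` then suffices.
  have hanti : AntitoneOn (fun y => ((u₁ y - u₂ y) ^ 2 + (v₁ y - v₂ y) ^ 2 + D ^ 2) *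
      Real.exp (-K * (y - α))) (Icc α β) := by
    refine antitoneOn_of_hasDerivAt_nonpos_off_finite
      (f' := fun y => (2 * (u₁ y - u₂ y) * (v₁ y - v₂ y) + 2 * (v₁ y - v₂ y) * (g₁ y - g₂ y)) *
        Real.exp (-K * (y - α)) + ((u₁ y - u₂ y) ^ 2 + (v₁ y - v₂ y) ^ 2 + D ^ 2) *
        (Real.exp (-K * (y - α)) * -K)) S ?_ ?_ ?_
    · exact ((((hu₁.sub hu₂).pow 2).add ((hv₁.sub hv₂).pow 2)).add continuousOn_const).mul
        (by fun_prop)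
    · intro y hy hyS
      have h1 := ((du₁ y hy).fun_sub (du₂ y hy)).fun_pow 2
      have h2 := ((dv₁ y hy hyS).fun_sub (dv₂ y hy hyS)).fun_pow 2
      have h3 : HasDerivAt (fun y : ℝ => Real.exp (-K * (y - α)))
          (Real.exp (-K * (y - α)) * -K) y := by
        have := (((hasDerivAt_id y).sub_const α).const_mul (-K)).exp
        simpa using this
      refine (((h1.fun_add h2).add_const (D ^ 2)).fun_mul h3).congr_deriv ?_
      push_cast
      ring
    · intro y hy hyS
      have hgy := hg y hy hyS
      have he := Real.exp_pos (-K * (y - α))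
      set w := u₁ y - u₂ y
      set z := v₁ y - v₂ y
      set G := g₁ y - g₂ y
      have h1 : z * G ≤ |z| * (L * |w| + D) := by
        calc z * G ≤ |z * G| := le_abs_self _
          _ = |z| * |G| := abs_mul _ _
          _ ≤ _ := by gcongr
      have h2 : 2 * (|z| * |w|) ≤ z ^ 2 + w ^ 2 := by
        rw [← sq_abs z, ← sq_abs w]
        nlinarith [sq_nonneg (|z| - |w|)]
      have h3 : 2 * (|z| * D) ≤ z ^ 2 + D ^ 2 := by
        rw [← sq_abs z]
        nlinarith [sq_nonneg (|z| - D)]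
      have h4 : 2 * (w * z) ≤ w ^ 2 + z ^ 2 := by nlinarith [sq_nonneg (w - z)]
      have h5 := mul_le_mul_of_nonneg_left h2 hL
      have h6 : 2 * w * z + 2 * z * G ≤ K * (w ^ 2 + z ^ 2 + D ^ 2) := by
        rw [hK]
        nlinarith [sq_nonneg w, sq_nonneg z, mul_nonneg hL (sq_nonneg D), sq_nonneg D]
      nlinarith
  have hα : α ∈ Icc α β := left_mem_Icc.2 (hx.1.trans hx.2)
  have h := hanti hα hx hx.1
  simp only [sub_self, mul_zero, Real.exp_zero, mul_one] at h
  have he : Real.exp (-K * (x - α)) * Real.exp (K * (x - α)) = 1 := by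
    rw [← Real.exp_add]; simp
  calc (u₁ x - u₂ x) ^ 2 + (v₁ x - v₂ x) ^ 2
      ≤ (u₁ x - u₂ x) ^ 2 + (v₁ x - v₂ x) ^ 2 + D ^ 2 := by linarith [sq_nonneg D]
    _ = ((u₁ x - u₂ x) ^ 2 + (v₁ x - v₂ x) ^ 2 + D ^ 2) * Real.exp (-K * (x - α)) *
        Real.exp (K * (x - α)) := by rw [mul_assoc, he, mul_one]
    _ ≤ _ := mul_le_mul_of_nonneg_right h (Real.exp_pos _).le

/-! ### The truncated nonlinearity, its trajectories and their energy. -/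

/-- At `0` both one-sided derivatives vanish because `1 < q`. Hence the energy is differentiable
even where a trajectory changes sign. -/
theorem hasDerivAt_max_zero_rpow {q : ℝ} (hq : 1 < q) (x : ℝ) :
    HasDerivAt (fun y : ℝ => (max y 0) ^ q) (q * (max x 0) ^ (q - 1)) x := by
  rcases lt_trichotomy x 0 with hx | rfl | hx
  · rw [max_eq_right hx.le, Real.zero_rpow (by linarith), mul_zero]
    refine (hasDerivAt_const x (0 : ℝ)).congr_of_eventuallyEq ?_
    filter_upwards [gt_mem_nhds hx] with y hy
    rw [max_eq_right hy.le, Real.zero_rpow (by linarith)]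
  · rw [max_self, Real.zero_rpow (by linarith), mul_zero]
    have h := Real.hasDerivAt_rpow_const (x := 0) (p := q) (Or.inr hq.le)
    rw [Real.zero_rpow (by linarith), mul_zero] at h
    rw [← hasDerivWithinAt_univ, ← Iic_union_Ici (a := (0 : ℝ))]
    refine HasDerivWithinAt.union ?_ ?_
    · refine (hasDerivWithinAt_const (0 : ℝ) (Iic 0) (0 : ℝ)).congr (fun y hy => ?_) ?_
      · rw [max_eq_right hy, Real.zero_rpow (by linarith)]
      · rw [max_self, Real.zero_rpow (by linarith)]
    · refine h.hasDerivWithinAt.congr (fun y hy => ?_) ?_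
      · rw [max_eq_left hy]
      · rw [max_self]
  · rw [max_eq_left hx.le]
    refine (Real.hasDerivAt_rpow_const (Or.inr hq.le)).congr_of_eventuallyEq ?_
    filter_upwards [lt_mem_nhds hx] with y hy
    rw [max_eq_left hy.le]

/-- The right-hand side of the equation where the weight is `1`, with `u` replaced by its positive
part. -/
noncomputable def force (p lam y : ℝ) : ℝ := lam * max y 0 + (max y 0) ^ p

theorem force_of_nonneg {p lam y : ℝ} (hy : 0 ≤ y) : force p lam y = lam * y + y ^ p := by
  rw [force, max_eq_left hy]

theorem force_of_nonpos {p lam y : ℝ} (hp : 1 < p) (hy : y ≤ 0) : force p lam y = 0 := by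
  rw [force, max_eq_right hy, Real.zero_rpow (by linarith)]; simp

theorem abs_rpow_sub_rpow_le {p B y z : ℝ} (hp : 1 < p) (hy0 : 0 ≤ y) (hyB : y ≤ B)
    (hz0 : 0 ≤ z) (hzB : z ≤ B) : |y ^ p - z ^ p| ≤ p * B ^ (p - 1) * |y - z| := by
  have h := (convex_Icc (0 : ℝ) B).norm_image_sub_le_of_norm_hasDerivWithin_le
    (f := fun t : ℝ => t ^ p) (f' := fun t => p * t ^ (p - 1)) (C := p * B ^ (p - 1))
    (x := z) (y := y)
    (fun t _ => (Real.hasDerivAt_rpow_const (Or.inr hp.le)).hasDerivWithinAt) ?_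
    ⟨hz0, hzB⟩ ⟨hy0, hyB⟩
  · simpa [Real.norm_eq_abs] using h
  · intro t ht
    rw [Real.norm_of_nonneg (mul_nonneg (by linarith) (Real.rpow_nonneg ht.1 _))]
    exact mul_le_mul_of_nonneg_left (Real.rpow_le_rpow ht.1 ht.2 (by linarith)) (by linarith)

/-- Upper bounds on `y` and `z` are enough, since the positive part discards negative values. -/
theorem abs_force_sub_le {p lam mu B y z : ℝ} (hp : 1 < p) (hB : 0 ≤ B) (hy : y ≤ B)
    (hz : z ≤ B) :
    |force p lam y - force p mu z| ≤ (|lam| + p * B ^ (p - 1)) * |y - z| + |lam - mu| * B := by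
  have hm : |max y 0 - max z 0| ≤ |y - z| := abs_max_sub_max_le_abs _ _ _
  have h1 := abs_rpow_sub_rpow_le hp (le_max_right y 0) (max_le hy hB) (le_max_right z 0)
    (max_le hz hB)
  have hpB : 0 ≤ p * B ^ (p - 1) := mul_nonneg (by linarith) (Real.rpow_nonneg hB _)
  have e : force p lam y - force p mu z = lam * (max y 0 - max z 0) + (lam - mu) * max z 0 +
      ((max y 0) ^ p - (max z 0) ^ p) := by unfold force; ring
  rw [e]
  calc _ ≤ |lam * (max y 0 - max z 0)| + |(lam - mu) * max z 0| +
      |(max y 0) ^ p - (max z 0) ^ p| := abs_add_three _ _ _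
    _ ≤ |lam| * |y - z| + |lam - mu| * B + p * B ^ (p - 1) * |y - z| := by
      rw [abs_mul, abs_mul, abs_of_nonneg (le_max_right z 0)]
      gcongr
      · exact max_le hz hB
      · exact h1.trans (mul_le_mul_of_nonneg_left hm hpB)
    _ = _ := by ring

/-- Trajectories on `[α, β]` of the equation where the weight is `1`. -/
structure IsTraj (p lam α β : ℝ) (u v : ℝ → ℝ) : Prop where
  contU : ContinuousOn u (Icc α β)
  contV : ContinuousOn v (Icc α β)
  derivU : ∀ x ∈ Ioo α β, HasDerivAt u (v x) x
  derivV : ∀ x ∈ Ioo α β, HasDerivAt v (-force p lam (u x)) x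

theorem IsTraj.mono {p lam α β γ δ : ℝ} {u v : ℝ → ℝ} (h : IsTraj p lam α β u v) (hα : α ≤ γ)
    (hβ : δ ≤ β) : IsTraj p lam γ δ u v where
  contU := h.contU.mono (Icc_subset_Icc hα hβ)
  contV := h.contV.mono (Icc_subset_Icc hα hβ)
  derivU x hx := h.derivU x (Ioo_subset_Ioo hα hβ hx)
  derivV x hx := h.derivV x (Ioo_subset_Ioo hα hβ hx)

theorem IsTraj.dist_le {p lam mu α β B : ℝ} {u₁ v₁ u₂ v₂ : ℝ → ℝ} (hp : 1 < p)
    (h₁ : IsTraj p lam α β u₁ v₁) (h₂ : IsTraj p mu α β u₂ v₂) (hB : 0 ≤ B)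
    (hu₁ : ∀ x ∈ Icc α β, u₁ x ≤ B) (hu₂ : ∀ x ∈ Icc α β, u₂ x ≤ B) {x : ℝ} (hx : x ∈ Icc α β) :
    (u₁ x - u₂ x) ^ 2 + (v₁ x - v₂ x) ^ 2 ≤
      ((u₁ α - u₂ α) ^ 2 + (v₁ α - v₂ α) ^ 2 + (|lam - mu| * B) ^ 2) *
        Real.exp ((2 + (|lam| + p * B ^ (p - 1))) * (x - α)) := by
  refine sq_add_sq_sub_le ∅ ?_ h₁.contU h₁.contV h₂.contU h₂.contV h₁.derivU h₂.derivU
    (fun y hy _ => h₁.derivV y hy) (fun y hy _ => h₂.derivV y hy) ?_ hx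
  · exact add_nonneg (abs_nonneg _) (mul_nonneg (by linarith) (Real.rpow_nonneg hB _))
  · intro y hy _
    have := abs_force_sub_le (lam := lam) (mu := mu) hp hB (hu₁ y (Ioo_subset_Icc_self hy))
      (hu₂ y (Ioo_subset_Icc_self hy))
    rwa [neg_sub_neg, abs_sub_comm]

theorem IsTraj.exists_bound {p lam α β : ℝ} {u v : ℝ → ℝ} (h : IsTraj p lam α β u v) :
    ∃ B, 0 ≤ B ∧ ∀ x ∈ Icc α β, |u x| ≤ B := by
  obtain ⟨B, hB⟩ := isCompact_Icc.exists_bound_of_continuousOn h.contU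
  exact ⟨max B 0, le_max_right _ _, fun x hx => (hB x hx).trans (le_max_left _ _)⟩

theorem IsTraj.eq_of_eq_left {p lam α β : ℝ} {u₁ v₁ u₂ v₂ : ℝ → ℝ} (hp : 1 < p)
    (h₁ : IsTraj p lam α β u₁ v₁) (h₂ : IsTraj p lam α β u₂ v₂) (hu : u₁ α = u₂ α)
    (hv : v₁ α = v₂ α) {x : ℝ} (hx : x ∈ Icc α β) : u₁ x = u₂ x ∧ v₁ x = v₂ x := by
  obtain ⟨B₁, hB₁, hb₁⟩ := h₁.exists_bound
  obtain ⟨B₂, hB₂, hb₂⟩ := h₂.exists_bound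
  have h := h₁.dist_le hp h₂ (B := max B₁ B₂) (hB₁.trans (le_max_left _ _))
    (fun x hx => (le_abs_self _).trans ((hb₁ x hx).trans (le_max_left _ _)))
    (fun x hx => (le_abs_self _).trans ((hb₂ x hx).trans (le_max_right _ _))) hx
  simp only [hu, hv, sub_self, abs_zero, zero_mul, ne_eq, OfNat.ofNat_ne_zero, not_false_eq_true,
    zero_pow, add_zero] at h
  constructor <;> nlinarith [sq_nonneg (u₁ x - u₂ x), sq_nonneg (v₁ x - v₂ x)]

/-- First integral of an autonomous equation: the derivative is zero, so the energy is both antitone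
and monotone. -/
theorem IsTraj.energy {p lam α β : ℝ} {u v : ℝ → ℝ} (hp : 1 < p)
    (h : IsTraj p lam α β u v) {x : ℝ} (hx : x ∈ Icc α β) :
    v x ^ 2 + lam * (max (u x) 0) ^ (2 : ℝ) + 2 / (p + 1) * (max (u x) 0) ^ (p + 1) =
      v α ^ 2 + lam * (max (u α) 0) ^ (2 : ℝ) + 2 / (p + 1) * (max (u α) 0) ^ (p + 1) := by
  have hc (q : ℝ) (hq : 0 ≤ q) : ContinuousOn (fun y => (max (u y) 0) ^ q) (Icc α β) :=
    (h.contU.sup continuousOn_const).rpow_const fun _ _ => Or.inr hq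
  have hcont : ContinuousOn (fun y => v y ^ 2 + lam * (max (u y) 0) ^ (2 : ℝ) +
      2 / (p + 1) * (max (u y) 0) ^ (p + 1)) (Icc α β) :=
    ((h.contV.pow 2).add ((hc 2 (by norm_num)).const_smul lam)).add
      ((hc (p + 1) (by linarith)).const_smul (2 / (p + 1)))
  have hd : ∀ y ∈ Ioo α β, HasDerivAt (fun y => v y ^ 2 + lam * (max (u y) 0) ^ (2 : ℝ) +
      2 / (p + 1) * (max (u y) 0) ^ (p + 1)) 0 y := by
    intro y hy
    have h1 := (h.derivV y hy).fun_pow 2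
    have h2 := ((hasDerivAt_max_zero_rpow (q := 2) (by norm_num) (u y)).comp y
      (h.derivU y hy)).const_mul lam
    have h3 := ((hasDerivAt_max_zero_rpow (q := p + 1) (by linarith) (u y)).comp y
      (h.derivU y hy)).const_mul (2 / (p + 1))
    refine ((h1.fun_add h2).fun_add h3).congr_deriv ?_
    have hp1 : p + 1 ≠ 0 := by linarith
    rw [add_sub_cancel_right, show (2 : ℝ) - 1 = 1 by norm_num, Real.rpow_one]
    unfold force
    field_simp
    push_cast
    ring
  have hα : α ∈ Icc α β := left_mem_Icc.2 (hx.1.trans hx.2)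
  have ha := antitoneOn_of_hasDerivAt_nonpos_off_finite ∅ hcont (fun y hy _ => hd y hy)
    (fun _ _ _ => le_rfl) hα hx hx.1
  have hm := monotoneOn_of_hasDerivAt_nonneg_off_finite ∅ hcont (fun y hy _ => hd y hy)
    (fun _ _ _ => le_rfl) hα hx hx.1
  exact le_antisymm ha hm

/-! ### A priori bounds and the shooting family. -/

theorem exists_first_ge {f : ℝ → ℝ} {α β m x : ℝ} (hf : ContinuousOn f (Icc α β))
    (hx : x ∈ Icc α β) (hm : m ≤ f x) :
    ∃ c ∈ Icc α β, m ≤ f c ∧ ∀ y ∈ Ico α c, f y < m := by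
  have hcl : IsClosed (Icc α β ∩ f ⁻¹' Ici m) :=
    hf.preimage_isClosed_of_isClosed isClosed_Icc isClosed_Ici
  have hbdd : BddBelow (Icc α β ∩ f ⁻¹' Ici m) := ⟨α, fun y hy => hy.1.1⟩
  have hc := hcl.csInf_mem ⟨x, hx, hm⟩ hbdd
  refine ⟨_, hc.1, hc.2, fun y hy => ?_⟩
  by_contra! h
  exact absurd (csInf_le hbdd ⟨⟨hy.1, hy.2.le.trans hc.1.2⟩, h⟩) (not_le.2 hy.2)

/-- The power `p + 1 > 2` dominates the quadratic term. The level is uniform for bounded `lam` and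
`s`, which later makes the dependence on the parameters locally Lipschitz. -/
theorem exists_sq_lt_potential {p : ℝ} (hp : 1 < p) (Λ S : ℝ) :
    ∃ B : ℝ, 0 < B ∧ ∀ lam, |lam| ≤ Λ → ∀ s, |s| ≤ S → ∀ y ≥ B,
      s ^ 2 < lam * y ^ (2 : ℝ) + 2 / (p + 1) * y ^ (p + 1) := by
  have ht : Tendsto (fun y : ℝ => y ^ (p - 1)) atTop atTop := tendsto_rpow_atTop (by linarith)
  obtain ⟨B, hB⟩ := eventually_atTop.1
    (ht.eventually_ge_atTop ((p + 1) / 2 * (Λ + S ^ 2 + 1)))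
  refine ⟨max B 1, lt_max_of_lt_right one_pos, fun lam hlam s hs y hy => ?_⟩
  have hy1 : 1 ≤ y := (le_max_right _ _).trans hy
  have hyB := hB y ((le_max_left _ _).trans hy)
  have hp1 : 0 < p + 1 := by linarith
  have e : y ^ (p + 1) = y ^ 2 * y ^ (p - 1) := by
    rw [← Real.rpow_natCast y 2, ← Real.rpow_add (by linarith)]
    congr 1; push_cast; ring
  have h2 : Λ + S ^ 2 + 1 ≤ 2 / (p + 1) * y ^ (p - 1) := by
    calc Λ + S ^ 2 + 1 = 2 / (p + 1) * ((p + 1) / 2 * (Λ + S ^ 2 + 1)) := by field_simp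
      _ ≤ _ := mul_le_mul_of_nonneg_left hyB (by positivity)
  have hs2 : s ^ 2 ≤ S ^ 2 := by
    rw [← sq_abs s]
    exact pow_le_pow_left₀ (abs_nonneg s) hs 2
  have h3 : S ^ 2 + 1 ≤ lam + 2 / (p + 1) * y ^ (p - 1) := by
    linarith [neg_abs_le lam]
  have h4 : 1 ≤ y ^ 2 := by nlinarith
  rw [Real.rpow_two, e]
  nlinarith [sq_nonneg S]

/-- At a level `≥ B` the potential energy alone would exceed the total energy `v 0 ^ 2`. -/
theorem IsTraj.lt_of_energy {p lam b B : ℝ} {u v : ℝ → ℝ} (hp : 1 < p)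
    (h : IsTraj p lam 0 b u v) (hu0 : u 0 = 0) (hB : 0 < B)
    (hE : ∀ y ≥ B, v 0 ^ 2 < lam * y ^ (2 : ℝ) + 2 / (p + 1) * y ^ (p + 1)) :
    ∀ x ∈ Icc 0 b, u x < B := by
  intro x hx
  by_contra! hBx
  have he := h.energy hp hx
  rw [hu0, max_self, Real.zero_rpow (by norm_num), Real.zero_rpow (by linarith),
    max_eq_left (hB.le.trans hBx)] at he
  have := hE _ hBx
  nlinarith [sq_nonneg (v x)]

/-- Picard–Lindelöf is applied to the field cut off above a level `B` that the energy forbids. The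
cutoff makes the force bounded and the field globally Lipschitz, and is then shown to be inactive.
-/
theorem exists_traj {p : ℝ} (hp : 1 < p) {a : ℝ} (ha0 : 0 < a) (ha : a ≤ 1 / 2) (lam s : ℝ) :
    ∃ u v : ℝ → ℝ, u 0 = 0 ∧ v 0 = s ∧ IsTraj p lam 0 a u v := by
  obtain ⟨B, hB, hE⟩ := exists_sq_lt_potential hp |lam| |s|
  replace hE := hE lam le_rfl s le_rfl
  set A : ℝ := |lam| * B + B ^ p with hA
  have hA0 : 0 ≤ A := by positivity
  -- On the ball of radius `R` about `(0, s)` the field is bounded by `2 * R`; in time `a ≤ 1 / 2` a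
  -- solution cannot leave it.
  set R : NNReal := ⟨|s| + A, by positivity⟩ with hR
  have hRv : (R : ℝ) = |s| + A := rfl
  set F : ℝ × ℝ → ℝ × ℝ := fun z => (z.2, -force p lam (min z.1 B)) with hF
  have hbound : ∀ y, |force p lam (min y B)| ≤ A := by
    intro y
    have h1 : 0 ≤ max (min y B) 0 := le_max_right _ _
    have h2 : max (min y B) 0 ≤ B := max_le (min_le_right _ _) hB.le
    unfold force
    refine (abs_add_le _ _).trans ?_
    rw [abs_mul, abs_of_nonneg h1, abs_of_nonneg (Real.rpow_nonneg h1 _)]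
    exact add_le_add (mul_le_mul_of_nonneg_left h2 (abs_nonneg _))
      (Real.rpow_le_rpow h1 h2 (by linarith))
  have hKnn : 0 ≤ |lam| + p * B ^ (p - 1) :=
    add_nonneg (abs_nonneg _) (mul_nonneg (by linarith) (Real.rpow_nonneg hB.le _))
  set K : NNReal := ⟨1 + (|lam| + p * B ^ (p - 1)), by positivity⟩ with hK
  have hlip : LipschitzWith K F := by
    refine LipschitzWith.of_dist_le_mul fun y z => ?_
    have hKv : (K : ℝ) = 1 + (|lam| + p * B ^ (p - 1)) := rfl
    have h1 : |y.1 - z.1| ≤ dist y z := by rw [Prod.dist_eq, ← Real.dist_eq]; exact le_max_left _ _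
    have h2 : |y.2 - z.2| ≤ dist y z := by rw [Prod.dist_eq, ← Real.dist_eq]; exact le_max_right _ _
    have h3 := abs_force_sub_le (lam := lam) (mu := lam) hp hB.le (min_le_right y.1 B)
      (min_le_right z.1 B)
    have h4 : |min y.1 B - min z.1 B| ≤ |y.1 - z.1| := abs_min_sub_min_le_max _ _ _ _ |>.trans
      (by simp)
    rw [Prod.dist_eq]
    refine max_le ?_ ?_
    · rw [hF, Real.dist_eq, hKv]
      nlinarith [abs_nonneg (y.2 - z.2)]
    · rw [hF, Real.dist_eq, hKv, neg_sub_neg, abs_sub_comm]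
      rw [sub_self, abs_zero, zero_mul, add_zero] at h3
      have := mul_le_mul_of_nonneg_left (h4.trans h1) hKnn
      have : 0 ≤ dist y z := dist_nonneg
      linarith
  have h0 : (0 : ℝ) ∈ Icc 0 a := ⟨le_rfl, ha0.le⟩
  have hPL : IsPicardLindelof (fun _ => F) (⟨0, h0⟩ : Icc 0 a) ((0, s) : ℝ × ℝ) R 0 (2 * R) K := by
    refine IsPicardLindelof.of_time_independent ?_ hlip.lipschitzOnWith ?_
    · intro z hz
      have hz2 : |z.2 - s| ≤ R := by
        rw [← Real.dist_eq]
        exact (le_max_right _ _).trans (by simpa [Prod.dist_eq] using hz)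
      rw [Prod.norm_def]
      have h1 : |z.2| ≤ 2 * R := by
        have := abs_sub_abs_le_abs_sub z.2 s
        linarith
      have h2 : |force p lam (min z.1 B)| ≤ 2 * R := by
        have := hbound z.1
        have := abs_nonneg s
        linarith
      push_cast
      exact max_le (by simpa [hF] using h1) (by simpa [hF] using h2)
    · have hR0 : (0 : ℝ) ≤ R := R.2
      simp only [sub_zero, sub_self]
      rw [max_eq_left ha0.le]
      push_cast
      nlinarith
  obtain ⟨z, hz0, hz⟩ := hPL.exists_eq_forall_mem_Icc_hasDerivWithinAt₀
  have hz0' : z 0 = (0, s) := hz0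
  have hzc : ContinuousOn z (Icc 0 a) := fun t ht => (hz t ht).continuousWithinAt
  have hd : ∀ t ∈ Ioo 0 a, HasDerivAt z (F (z t)) t := fun t ht =>
    (hz t (Ioo_subset_Icc_self ht)).hasDerivAt (Icc_mem_nhds ht.1 ht.2)
  have hu : ContinuousOn (fun t => (z t).1) (Icc 0 a) := continuous_fst.comp_continuousOn hzc
  have hv : ContinuousOn (fun t => (z t).2) (Icc 0 a) := continuous_snd.comp_continuousOn hzc
  have hdu : ∀ t ∈ Ioo 0 a, HasDerivAt (fun t => (z t).1) ((z t).2) t := fun t ht =>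
    (hasFDerivAt_fst (𝕜 := ℝ) (p := z t)).comp_hasDerivAt t (hd t ht)
  have hdv : ∀ t ∈ Ioo 0 a, HasDerivAt (fun t => (z t).2) (-force p lam (min (z t).1 B)) t :=
    fun t ht => (hasFDerivAt_snd (𝕜 := ℝ) (p := z t)).comp_hasDerivAt t (hd t ht)
  -- the truncation is inactive
  have hlt : ∀ t ∈ Icc 0 a, (z t).1 < B := by
    by_contra! hcon
    obtain ⟨t₁, ht₁, hBt⟩ := hcon
    -- Up to the first time `c` at level `B` the original equation holds, so the energy bound
    -- already applies on `[0, c]`.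
    obtain ⟨c, hc, hBc, hlow⟩ := exists_first_ge hu ht₁ hBt
    have htr : IsTraj p lam 0 c (fun t => (z t).1) (fun t => (z t).2) := by
      refine ⟨hu.mono (Icc_subset_Icc_right hc.2), hv.mono (Icc_subset_Icc_right hc.2),
        fun t ht => hdu t ⟨ht.1, ht.2.trans_le hc.2⟩, fun t ht => ?_⟩
      have := hdv t ⟨ht.1, ht.2.trans_le hc.2⟩
      rwa [min_eq_left (hlow t ⟨ht.1.le, ht.2⟩).le] at this
    have := htr.lt_of_energy hp (by rw [hz0']) hB (by rw [hz0']; exact hE) c ⟨hc.1, le_rfl⟩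
    exact absurd hBc (not_le.2 this)
  refine ⟨fun t => (z t).1, fun t => (z t).2, by simp [hz0'], by simp [hz0'], hu, hv, hdu,
    fun t ht => ?_⟩
  have := hdv t ht
  rwa [min_eq_left (hlt t (Ioo_subset_Icc_self ht)).le] at this

/-- A family of trajectories on `[0, a]` issued from `u = 0`, `u' = s`. -/
structure IsShooting (p a : ℝ) (X Y : ℝ → ℝ → ℝ → ℝ) : Prop where
  zero_left : ∀ lam s, X lam s 0 = 0
  deriv_left : ∀ lam s, Y lam s 0 = s
  traj : ∀ lam s, IsTraj p lam 0 a (X lam s) (Y lam s)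

theorem exists_shooting {p : ℝ} (hp : 1 < p) {a : ℝ} (ha0 : 0 < a) (ha : a ≤ 1 / 2) :
    ∃ X Y, IsShooting p a X Y := by
  choose X Y h0 h1 h2 using exists_traj hp ha0 ha
  exact ⟨X, Y, h0, h1, h2⟩

theorem IsShooting.dist_le {p a : ℝ} {X Y : ℝ → ℝ → ℝ → ℝ} (hp : 1 < p)
    (hX : IsShooting p a X Y) (Λ S : ℝ) : ∃ C : ℝ, 0 ≤ C ∧
      ∀ lam mu s t, |lam| ≤ Λ → |mu| ≤ Λ → |s| ≤ S → |t| ≤ S → ∀ x ∈ Icc 0 a,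
        (X lam s x - X mu t x) ^ 2 + (Y lam s x - Y mu t x) ^ 2 ≤
          C * ((s - t) ^ 2 + (lam - mu) ^ 2) := by
  obtain ⟨B, hB, hE⟩ := exists_sq_lt_potential hp Λ S
  have hq : 0 ≤ p * B ^ (p - 1) := mul_nonneg (by linarith) (Real.rpow_nonneg hB.le _)
  refine ⟨(1 + B ^ 2) * Real.exp ((2 + (Λ + p * B ^ (p - 1))) * a), by positivity, ?_⟩
  intro lam mu s t hlam hmu hs ht x hx
  have hb : ∀ lam s, |lam| ≤ Λ → |s| ≤ S → ∀ x ∈ Icc 0 a, X lam s x ≤ B :=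
    fun lam s hlam hs x hx => ((hX.traj lam s).lt_of_energy hp (hX.zero_left _ _) hB
      (by rw [hX.deriv_left]; exact hE lam hlam s hs) x hx).le
  have h := (hX.traj lam s).dist_le hp (hX.traj mu t) hB.le (hb lam s hlam hs) (hb mu t hmu ht) hx
  rw [hX.zero_left, hX.zero_left, hX.deriv_left, hX.deriv_left, sub_zero, sub_zero, mul_pow,
    sq_abs] at h
  refine h.trans ?_
  have he : Real.exp ((2 + (|lam| + p * B ^ (p - 1))) * x) ≤
      Real.exp ((2 + (Λ + p * B ^ (p - 1))) * a) := by
    refine Real.exp_le_exp.2 (mul_le_mul (by linarith) hx.2 hx.1 ?_)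
    have := abs_nonneg lam
    linarith
  calc _ ≤ ((1 + B ^ 2) * ((s - t) ^ 2 + (lam - mu) ^ 2)) *
        Real.exp ((2 + (Λ + p * B ^ (p - 1))) * a) := by
        refine mul_le_mul ?_ he (Real.exp_pos _).le (by positivity)
        nlinarith [sq_nonneg B, sq_nonneg (s - t), sq_nonneg (lam - mu),
          mul_nonneg (sq_nonneg B) (sq_nonneg (s - t))]
    _ = _ := by ring

/-- The change of parameters is controlled uniformly in `x` by `dist_le`; the change of `x` only
involves the fixed trajectory at `(lam₀, s₀)`. -/
theorem IsShooting.continuousOn {p a : ℝ} {X Y : ℝ → ℝ → ℝ → ℝ} (hp : 1 < p)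
    (hX : IsShooting p a X Y) :
    ContinuousOn (fun q : ℝ × ℝ × ℝ => (X q.1 q.2.1 q.2.2, Y q.1 q.2.1 q.2.2))
      {q | q.2.2 ∈ Icc 0 a} := by
  rintro ⟨lam₀, s₀, x₀⟩ (hx₀ : x₀ ∈ Icc 0 a)
  obtain ⟨C, hC, hCb⟩ := hX.dist_le hp (|lam₀| + 1) (|s₀| + 1)
  have hmain : Tendsto (fun q : ℝ × ℝ × ℝ =>
      C * ((q.2.1 - s₀) ^ 2 + (q.1 - lam₀) ^ 2)) (𝓝[{q | q.2.2 ∈ Icc 0 a}] (lam₀, s₀, x₀))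
      (𝓝 0) := by
    have : Continuous (fun q : ℝ × ℝ × ℝ => C * ((q.2.1 - s₀) ^ 2 + (q.1 - lam₀) ^ 2)) := by
      fun_prop
    have h := (this.tendsto (lam₀, s₀, x₀)).mono_left
      (nhdsWithin_le_nhds (s := {q : ℝ × ℝ × ℝ | q.2.2 ∈ Icc 0 a}))
    simpa using h
  have hsqrt := hmain.sqrt
  rw [Real.sqrt_zero] at hsqrt
  have hnear : ∀ᶠ q : ℝ × ℝ × ℝ in 𝓝[{q | q.2.2 ∈ Icc 0 a}] (lam₀, s₀, x₀),
      |q.1| ≤ |lam₀| + 1 ∧ |q.2.1| ≤ |s₀| + 1 ∧ q.2.2 ∈ Icc 0 a := by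
    have c1 : ContinuousAt (fun q : ℝ × ℝ × ℝ => |q.1|) (lam₀, s₀, x₀) := by fun_prop
    have c2 : ContinuousAt (fun q : ℝ × ℝ × ℝ => |q.2.1|) (lam₀, s₀, x₀) := by fun_prop
    filter_upwards [mem_nhdsWithin_of_mem_nhds (c1.eventually (gt_mem_nhds (lt_add_one |lam₀|))),
      mem_nhdsWithin_of_mem_nhds (c2.eventually (gt_mem_nhds (lt_add_one |s₀|))),
      self_mem_nhdsWithin] with q h1 h2 h3
    exact ⟨le_of_lt h1, le_of_lt h2, h3⟩
  have hl : |lam₀| ≤ |lam₀| + 1 := by linarith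
  have hs : |s₀| ≤ |s₀| + 1 := by linarith
  have hsnd : Tendsto (fun q : ℝ × ℝ × ℝ => q.2.2) (𝓝[{q | q.2.2 ∈ Icc 0 a}] (lam₀, s₀, x₀))
      (𝓝[Icc 0 a] x₀) := by
    refine tendsto_nhdsWithin_iff.2 ⟨?_, eventually_mem_nhdsWithin⟩
    exact (by fun_prop : Continuous fun q : ℝ × ℝ × ℝ => q.2.2).tendsto (lam₀, s₀, x₀)
      |>.mono_left nhdsWithin_le_nhds
  refine Tendsto.prodMk_nhds ?_ ?_
  · have h1 : Tendsto (fun q : ℝ × ℝ × ℝ => X q.1 q.2.1 q.2.2 - X lam₀ s₀ q.2.2)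
        (𝓝[{q | q.2.2 ∈ Icc 0 a}] (lam₀, s₀, x₀)) (𝓝 0) := by
      refine squeeze_zero_norm' ?_ hsqrt
      filter_upwards [hnear] with q hq
      refine Real.abs_le_sqrt ?_
      have := hCb q.1 lam₀ q.2.1 s₀ hq.1 hl hq.2.1 hs q.2.2 hq.2.2
      nlinarith [sq_nonneg (Y q.1 q.2.1 q.2.2 - Y lam₀ s₀ q.2.2)]
    have h2 := (((hX.traj lam₀ s₀).contU x₀ hx₀).tendsto).comp hsnd
    simpa using h1.add h2
  · have h1 : Tendsto (fun q : ℝ × ℝ × ℝ => Y q.1 q.2.1 q.2.2 - Y lam₀ s₀ q.2.2)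
        (𝓝[{q | q.2.2 ∈ Icc 0 a}] (lam₀, s₀, x₀)) (𝓝 0) := by
      refine squeeze_zero_norm' ?_ hsqrt
      filter_upwards [hnear] with q hq
      refine Real.abs_le_sqrt ?_
      have := hCb q.1 lam₀ q.2.1 s₀ hq.1 hl hq.2.1 hs q.2.2 hq.2.2
      nlinarith [sq_nonneg (X q.1 q.2.1 q.2.2 - X lam₀ s₀ q.2.2)]
    have h2 := (((hX.traj lam₀ s₀).contV x₀ hx₀).tendsto).comp hsnd
    simpa using h1.add h2

/-! ### Even solutions of the linear equation in the gap. -/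

/-- The solution of `-φ'' = lam * φ`, `φ (1/2) = 1`, `φ' (1/2) = 0`. One of the two square roots
vanishes, so that the formula covers both signs of `lam`. -/
noncomputable def mode (lam x : ℝ) : ℝ :=
  Real.cos (√lam * (x - 1 / 2)) * Real.cosh (√(-lam) * (x - 1 / 2))

/-- The derivative of `mode`. -/
noncomputable def modeDeriv (lam x : ℝ) : ℝ :=
  -√lam * Real.sin (√lam * (x - 1 / 2)) * Real.cosh (√(-lam) * (x - 1 / 2)) +
    √(-lam) * Real.cos (√lam * (x - 1 / 2)) * Real.sinh (√(-lam) * (x - 1 / 2))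

theorem continuous_mode : Continuous fun q : ℝ × ℝ => mode q.1 q.2 := by
  unfold mode
  exact (Real.continuous_cos.comp (by fun_prop)).mul (Real.continuous_cosh.comp (by fun_prop))

theorem continuous_modeDeriv : Continuous fun q : ℝ × ℝ => modeDeriv q.1 q.2 := by
  unfold modeDeriv
  have h1 : Continuous fun q : ℝ × ℝ => Real.cosh (√(-q.1) * (q.2 - 1 / 2)) :=
    Real.continuous_cosh.comp (by fun_prop)
  have h2 : Continuous fun q : ℝ × ℝ => Real.sinh (√(-q.1) * (q.2 - 1 / 2)) :=
    Real.continuous_sinh.comp (by fun_prop)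
  fun_prop

theorem continuous_mode_right (lam : ℝ) : Continuous (mode lam) :=
  continuous_mode.comp (Continuous.prodMk_right lam)

theorem continuous_modeDeriv_right (lam : ℝ) : Continuous (modeDeriv lam) :=
  continuous_modeDeriv.comp (Continuous.prodMk_right lam)

theorem hasDerivAt_mode (lam x : ℝ) : HasDerivAt (mode lam) (modeDeriv lam x) x := by
  have hl (k : ℝ) : HasDerivAt (fun y : ℝ => k * (y - 1 / 2)) k x := by
    simpa using ((hasDerivAt_id x).sub_const (1 / 2 : ℝ)).const_mul k
  refine ((hl √lam).cos.fun_mul (hl √(-lam)).cosh).congr_deriv ?_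
  unfold modeDeriv
  ring

theorem sqrt_mul_sqrt_neg (lam : ℝ) : √lam * √(-lam) = 0 := by
  rcases le_total lam 0 with h | h
  · rw [Real.sqrt_eq_zero_of_nonpos h, zero_mul]
  · rw [Real.sqrt_eq_zero_of_nonpos (neg_nonpos.2 h), mul_zero]

theorem sqrt_sq_sub_sqrt_neg_sq (lam : ℝ) : √lam ^ 2 - √(-lam) ^ 2 = lam := by
  rcases le_total lam 0 with h | h
  · rw [Real.sqrt_eq_zero_of_nonpos h, Real.sq_sqrt (neg_nonneg.2 h)]; ring
  · rw [Real.sqrt_eq_zero_of_nonpos (neg_nonpos.2 h), Real.sq_sqrt h]; ring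

theorem hasDerivAt_modeDeriv (lam x : ℝ) :
    HasDerivAt (modeDeriv lam) (-(lam * mode lam x)) x := by
  have hl (k : ℝ) : HasDerivAt (fun y : ℝ => k * (y - 1 / 2)) k x := by
    simpa using ((hasDerivAt_id x).sub_const (1 / 2 : ℝ)).const_mul k
  have h1 := ((hl √lam).sin.const_mul (-√lam)).fun_mul (hl √(-lam)).cosh
  have h2 := ((hl √lam).cos.const_mul √(-lam)).fun_mul (hl √(-lam)).sinh
  refine (h1.fun_add h2).congr_deriv ?_
  have e1 := sqrt_mul_sqrt_neg lam
  have e2 := sqrt_sq_sub_sqrt_neg_sq lam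
  unfold mode
  linear_combination (-Real.cos (√lam * (x - 1 / 2)) * Real.cosh (√(-lam) * (x - 1 / 2))) * e2 -
    (2 * Real.sin (√lam * (x - 1 / 2)) * Real.sinh (√(-lam) * (x - 1 / 2))) * e1

theorem mode_one_sub (lam x : ℝ) : mode lam (1 - x) = mode lam x := by
  unfold mode
  rw [show (1 - x - 1 / 2 : ℝ) = -(x - 1 / 2) by ring, mul_neg, mul_neg, Real.cos_neg,
    Real.cosh_neg]

theorem modeDeriv_half (lam : ℝ) : modeDeriv lam (1 / 2) = 0 := by
  simp [modeDeriv]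

theorem mode_pos_of_abs_lt {lam x : ℝ} (h : √lam * |x - 1 / 2| < Real.pi / 2) :
    0 < mode lam x := by
  refine mul_pos (Real.cos_pos_of_mem_Ioo ?_) (Real.cosh_pos _)
  rw [mem_Ioo, ← abs_lt, abs_mul, abs_of_nonneg (Real.sqrt_nonneg _)]
  exact h

theorem sqrt_le_pi {lam : ℝ} (h : lam ≤ Real.pi ^ 2) : √lam ≤ Real.pi :=
  Real.sqrt_le_iff.2 ⟨Real.pi_pos.le, h⟩

theorem mode_pos {lam x : ℝ} (h : lam ≤ Real.pi ^ 2) (hx0 : 0 < x) (hx1 : x < 1) :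
    0 < mode lam x := by
  apply mode_pos_of_abs_lt
  have h1 : |x - 1 / 2| < 1 / 2 := abs_lt.2 ⟨by linarith, by linarith⟩
  calc √lam * |x - 1 / 2| ≤ Real.pi * |x - 1 / 2| :=
        mul_le_mul_of_nonneg_right (sqrt_le_pi h) (abs_nonneg _)
    _ < Real.pi * (1 / 2) := mul_lt_mul_of_pos_left h1 Real.pi_pos
    _ = _ := by ring

theorem mode_pos_of_lt {lam x : ℝ} (h : lam < Real.pi ^ 2) (hx0 : 0 ≤ x) (hx1 : x ≤ 1) :
    0 < mode lam x := by
  apply mode_pos_of_abs_lt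
  have h1 : |x - 1 / 2| ≤ 1 / 2 := abs_le.2 ⟨by linarith, by linarith⟩
  have h2 : √lam < Real.pi := (Real.sqrt_lt' Real.pi_pos).2 h
  calc √lam * |x - 1 / 2| ≤ √lam * (1 / 2) :=
        mul_le_mul_of_nonneg_left h1 (Real.sqrt_nonneg _)
    _ < Real.pi * (1 / 2) := by linarith
    _ = _ := by ring

theorem mode_nonneg {lam x : ℝ} (h : lam ≤ Real.pi ^ 2) (hx0 : 0 ≤ x) (hx1 : x ≤ 1) :
    0 ≤ mode lam x := by
  have hcl : IsClosed {y | 0 ≤ mode lam y} := isClosed_le continuous_const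
    (continuous_mode_right lam)
  have : Icc (0 : ℝ) 1 ⊆ {y | 0 ≤ mode lam y} := by
    rw [← closure_Ioo (by norm_num : (0 : ℝ) ≠ 1)]
    exact closure_minimal (fun y hy => (mode_pos h hy.1 hy.2).le) hcl
  exact this ⟨hx0, hx1⟩

theorem mode_pi_sq_zero : mode (Real.pi ^ 2) 0 = 0 := by
  unfold mode
  rw [Real.sqrt_sq Real.pi_pos.le, show Real.pi * (0 - 1 / 2) = -(Real.pi / 2) by ring,
    Real.cos_neg, Real.cos_pi_div_two, zero_mul]

theorem mode_pi_sq_one : mode (Real.pi ^ 2) 1 = 0 := by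
  rw [← mode_one_sub, sub_self, mode_pi_sq_zero]

/-- This is the height at `0` of the tangent to `mode lam` at `a`. For `lam ≤ 0`, `mode lam` is
convex with critical point `1 / 2`, so its slope at `a` is nonpositive. For `lam ≥ 0` the tangent
height increases with the point of contact, from `mode lam 0 ≥ 0`. -/
theorem mode_sub_mul_modeDeriv_nonneg {lam a : ℝ} (h : lam ≤ Real.pi ^ 2) (ha0 : 0 < a)
    (ha : a ≤ 1 / 2) : 0 ≤ mode lam a - a * modeDeriv lam a := by
  rcases le_total lam 0 with hl | hl
  · have hm : MonotoneOn (modeDeriv lam) (Icc a (1 / 2)) := by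
      refine monotoneOn_of_hasDerivAt_nonneg_off_finite ∅
        (continuous_modeDeriv_right lam).continuousOn
        (fun x _ _ => hasDerivAt_modeDeriv lam x) (fun x hx _ => ?_)
      have := mode_pos h (ha0.trans hx.1) (by linarith [hx.2])
      nlinarith
    have h1 := hm (left_mem_Icc.2 ha) (right_mem_Icc.2 ha) ha
    rw [modeDeriv_half] at h1
    have := mode_pos h ha0 (by linarith)
    nlinarith
  · have hm : MonotoneOn (fun x => mode lam x - x * modeDeriv lam x) (Icc 0 a) := by
      refine monotoneOn_of_hasDerivAt_nonneg_off_finite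
        (f' := fun x => x * (lam * mode lam x)) ∅ ?_ ?_ ?_
      · exact ((continuous_mode_right lam).sub
          (continuous_id.mul (continuous_modeDeriv_right lam))).continuousOn
      · intro x _ _
        refine ((hasDerivAt_mode lam x).fun_sub
          ((hasDerivAt_id' x).fun_mul (hasDerivAt_modeDeriv lam x))).congr_deriv ?_
        ring
      · intro x hx _
        exact mul_nonneg hx.1.le
          (mul_nonneg hl (mode_pos h hx.1 (by linarith [hx.2])).le)
    have h1 := hm (left_mem_Icc.2 ha0.le) (right_mem_Icc.2 ha0.le) ha0.le
    simp only [zero_mul, sub_zero] at h1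
    exact (mode_nonneg h le_rfl zero_le_one).trans h1

/-- The height at `c` of the same tangent is a convex combination of its heights at `0` and `a`,
with weight `c / a > 0` on the positive value at `a`. -/
theorem mode_sub_mul_modeDeriv_pos {lam a c : ℝ} (h : lam ≤ Real.pi ^ 2) (hc0 : 0 < c)
    (hca : c ≤ a) (ha : a ≤ 1 / 2) : 0 < mode lam a - (a - c) * modeDeriv lam a := by
  have ha0 := hc0.trans_le hca
  have h1 := mode_sub_mul_modeDeriv_nonneg h ha0 ha
  have h2 := mode_pos h ha0 (by linarith)
  have e : a * (mode lam a - (a - c) * modeDeriv lam a) =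
      c * mode lam a + (a - c) * (mode lam a - a * modeDeriv lam a) := by ring
  have : 0 < a * (mode lam a - (a - c) * modeDeriv lam a) := by
    rw [e]
    exact add_pos_of_pos_of_nonneg (mul_pos hc0 h2) (mul_nonneg (sub_nonneg.2 hca) h1)
  exact pos_of_mul_pos_right this ha0.le

/-! ### First crossings and the sign of a trajectory. -/

theorem exists_first_eq {f : ℝ → ℝ} {α β m x : ℝ} (hf : ContinuousOn f (Icc α β))
    (hx : x ∈ Icc α β) (hm : m ≤ f x) (hα : f α < m) :
    ∃ c ∈ Ioc α β, f c = m ∧ ∀ y ∈ Ico α c, f y < m := by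
  obtain ⟨c, hc, hmc, hlt⟩ := exists_first_ge hf hx hm
  have hαc : α < c := by
    refine lt_of_le_of_ne hc.1 ?_
    rintro rfl
    exact absurd hmc (not_le.2 hα)
  refine ⟨c, ⟨hαc, hc.2⟩, ?_, hlt⟩
  obtain ⟨y, hy, hym⟩ := intermediate_value_Icc hαc.le (hf.mono (Icc_subset_Icc_right hc.2))
    ⟨hα.le, hmc⟩
  rcases hy.2.lt_or_eq with h | h
  · exact absurd hym (hlt y ⟨hy.1, h⟩).ne
  · rw [← h, hym]

theorem exists_pos_left {f : ℝ → ℝ} {α β c : ℝ} (hf : ContinuousOn f (Icc α β)) (hαc : α < c)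
    (hcβ : c ≤ β) (hc : 0 < f c) : ∃ d ∈ Ico α c, ∀ x ∈ Icc d c, 0 < f x := by
  obtain ⟨δ, hδ, h⟩ := Metric.continuousOn_iff.1 hf c ⟨hαc.le, hcβ⟩ (f c) hc
  refine ⟨max α (c - δ / 2), ⟨le_max_left _ _, max_lt hαc (by linarith)⟩, fun x hx => ?_⟩
  have h1 := h x ⟨(le_max_left _ _).trans hx.1, hx.2.trans hcβ⟩ (by
    rw [Real.dist_eq, abs_lt]
    have := (le_max_right _ _).trans hx.1
    exact ⟨by linarith, by linarith [hx.2]⟩)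
  rw [Real.dist_eq, abs_lt] at h1
  linarith [h1.1]

theorem exists_pos_right {f : ℝ → ℝ} {α β c : ℝ} (hf : ContinuousOn f (Icc α β)) (hαc : α ≤ c)
    (hcβ : c < β) (hc : 0 < f c) : ∃ d ∈ Ioc c β, ∀ x ∈ Icc c d, 0 < f x := by
  obtain ⟨δ, hδ, h⟩ := Metric.continuousOn_iff.1 hf c ⟨hαc, hcβ.le⟩ (f c) hc
  refine ⟨min β (c + δ / 2), ⟨lt_min hcβ (by linarith), min_le_left _ _⟩, fun x hx => ?_⟩
  have h1 := h x ⟨hαc.trans hx.1, hx.2.trans (min_le_left _ _)⟩ (by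
    rw [Real.dist_eq, abs_lt]
    have := hx.2.trans (min_le_right _ _)
    exact ⟨by linarith [hx.1], by linarith⟩)
  rw [Real.dist_eq, abs_lt] at h1
  linarith [h1.1]

theorem lt_of_hasDerivAt_pos {f f' : ℝ → ℝ} {α β : ℝ} (h : α < β) (hc : ContinuousOn f (Icc α β))
    (hd : ∀ x ∈ Ioo α β, HasDerivAt f (f' x) x) (hpos : ∀ x ∈ Ioo α β, 0 < f' x) :
    f α < f β := by
  refine strictMonoOn_of_deriv_pos (convex_Icc α β) hc ?_ (left_mem_Icc.2 h.le)
    (right_mem_Icc.2 h.le) h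
  rw [interior_Icc]
  intro x hx
  rw [(hd x hx).deriv]
  exact hpos x hx

theorem IsTraj.exists_pos_near_zero {p lam a : ℝ} {u v : ℝ → ℝ} (ha : 0 < a)
    (h : IsTraj p lam 0 a u v) (hu0 : u 0 = 0) (hv0 : 0 < v 0) :
    ∃ d ∈ Ioc 0 a, ∀ x ∈ Ioc 0 d, 0 < u x := by
  obtain ⟨d, hd, hpos⟩ := exists_pos_right h.contV le_rfl ha hv0
  refine ⟨d, hd, fun x hx => ?_⟩
  have := lt_of_hasDerivAt_pos hx.1 (h.contU.mono (Icc_subset_Icc_right (hx.2.trans hd.2)))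
    (fun y hy => h.derivU y ⟨hy.1, hy.2.trans_le (hx.2.trans hd.2)⟩)
    (fun y hy => hpos y ⟨hy.1.le, hy.2.le.trans hx.2⟩)
  rwa [hu0] at this

theorem IsTraj.energy_zero {p lam b : ℝ} {u v : ℝ → ℝ} (hp : 1 < p)
    (h : IsTraj p lam 0 b u v) (hu0 : u 0 = 0) {x : ℝ} (hx : x ∈ Icc 0 b) (hux : 0 ≤ u x) :
    v x ^ 2 + lam * u x ^ 2 + 2 / (p + 1) * u x ^ (p + 1) = v 0 ^ 2 := by
  have he := h.energy hp hx
  rw [hu0, max_self, Real.zero_rpow (by norm_num), Real.zero_rpow (by linarith),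
    max_eq_left hux, Real.rpow_two] at he
  linarith

/-- At the first zero `c` the energy gives `v c ^ 2 = v 0 ^ 2`, so the zero is simple; a positive
slope there would make `u` negative just before `c`. -/
theorem IsTraj.pos_or_exists_zero {p lam a : ℝ} {u v : ℝ → ℝ} (hp : 1 < p) (ha : 0 < a)
    (h : IsTraj p lam 0 a u v) (hu0 : u 0 = 0) (hv0 : 0 < v 0) :
    (∀ x ∈ Ioc 0 a, 0 < u x) ∨
      ∃ c ∈ Ioc 0 a, (∀ x ∈ Ioo 0 c, 0 < u x) ∧ u c = 0 ∧ v c < 0 := by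
  obtain ⟨d, hd, hpos⟩ := h.exists_pos_near_zero ha hu0 hv0
  by_cases hall : ∀ x ∈ Ioc 0 a, 0 < u x
  · exact Or.inl hall
  right
  push Not at hall
  obtain ⟨x, hx, hux⟩ := hall
  have hdx : d ≤ x := by
    by_contra! hxd
    exact absurd hux (not_le.2 (hpos x ⟨hx.1, hxd.le⟩))
  obtain ⟨c, hc, huc, hlt⟩ := exists_first_eq (f := fun y => -u y) (m := 0)
    ((h.contU.mono (Icc_subset_Icc_left hd.1.le)).neg) ⟨hdx, hx.2⟩ (by linarith)
    (by linarith [hpos d ⟨hd.1, le_rfl⟩])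
  have hc0 : 0 < c := hd.1.trans hc.1
  have huc0 : u c = 0 := by linarith
  have hposc : ∀ y ∈ Ioo 0 c, 0 < u y := by
    intro y hy
    rcases le_total y d with hyd | hyd
    · exact hpos y ⟨hy.1, hyd⟩
    · have := hlt y ⟨hyd, hy.2⟩
      linarith
  refine ⟨c, ⟨hc0, hc.2⟩, hposc, huc0, ?_⟩
  have he := h.energy_zero hp hu0 ⟨hc0.le, hc.2⟩ huc0.ge
  rw [huc0, Real.zero_rpow (by linarith)] at he
  by_contra! hvc
  have hvc' : 0 < v c := lt_of_le_of_ne hvc (by rintro h0; rw [← h0] at he; nlinarith)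
  obtain ⟨e, he', hve⟩ := exists_pos_left h.contV hc0 hc.2 hvc'
  have hm : (e + c) / 2 < c := by linarith [he'.2]
  have hm0 : 0 < (e + c) / 2 := by linarith [he'.1]
  have := lt_of_hasDerivAt_pos hm (h.contU.mono (Icc_subset_Icc hm0.le hc.2))
    (fun y hy => h.derivU y ⟨hm0.trans hy.1, hy.2.trans_le hc.2⟩)
    (fun y hy => hve y ⟨by linarith [hy.1, he'.2], hy.2.le⟩)
  have := hposc _ ⟨hm0, hm⟩
  linarith

/-! ### Wronskian comparison of two trajectories. -/

theorem rpow_eq_rpow_sub_one_mul {p y : ℝ} (hp : 1 < p) (hy : 0 ≤ y) :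
    y ^ p = y ^ (p - 1) * y := by
  rcases hy.eq_or_lt with rfl | hy
  · rw [Real.zero_rpow (by linarith), mul_zero]
  · rw [← Real.rpow_add_one hy.ne', sub_add_cancel]

/-- Two positive trajectories issued from `0` with different slopes are nowhere proportional to
first order. -/
theorem IsTraj.wronskian_neg {p lam a : ℝ} {u₁ v₁ u₂ v₂ : ℝ → ℝ} (hp : 1 < p) (ha : 0 < a)
    (h₁ : IsTraj p lam 0 a u₁ v₁) (h₂ : IsTraj p lam 0 a u₂ v₂) (hu₁ : u₁ 0 = 0)
    (hu₂ : u₂ 0 = 0) (hv₁ : 0 < v₁ 0) (hv : v₁ 0 < v₂ 0)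
    (hpos₁ : ∀ x ∈ Ioc 0 a, 0 < u₁ x) (hpos₂ : ∀ x ∈ Ioc 0 a, 0 < u₂ x) :
    v₂ a * u₁ a - v₁ a * u₂ a < 0 := by
  set W : ℝ → ℝ := fun x => v₂ x * u₁ x - v₁ x * u₂ x with hW
  have hWc : ContinuousOn W (Icc 0 a) :=
    (h₂.contV.mul h₁.contU).sub (h₁.contV.mul h₂.contU)
  -- `W' = -(u₂ ^ (p - 1) - u₁ ^ (p - 1)) * u₁ * u₂`: the Wronskian decreases as long as `u₁ < u₂`.
  have hstep : ∀ d c, 0 ≤ d → d < c → c ≤ a → (∀ x ∈ Ioo d c, u₁ x < u₂ x) → W c < W d := by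
    intro d c hd hdc hca hlt
    have h := lt_of_hasDerivAt_pos (f := fun x => -W x)
      (f' := fun x => (u₂ x ^ (p - 1) - u₁ x ^ (p - 1)) * (u₁ x * u₂ x)) hdc
      (hWc.mono (Icc_subset_Icc hd hca)).neg ?_ ?_
    · linarith
    · intro x hx
      have hx' : x ∈ Ioo 0 a := ⟨hd.trans_lt hx.1, hx.2.trans_le hca⟩
      have p1 := hpos₁ x (Ioo_subset_Ioc_self hx')
      have p2 := hpos₂ x (Ioo_subset_Ioc_self hx')
      refine ((((h₂.derivV x hx').fun_mul (h₁.derivU x hx')).fun_sub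
        ((h₁.derivV x hx').fun_mul (h₂.derivU x hx'))).fun_neg).congr_deriv ?_
      rw [force_of_nonneg p1.le, force_of_nonneg p2.le, rpow_eq_rpow_sub_one_mul hp p1.le,
        rpow_eq_rpow_sub_one_mul hp p2.le]
      ring
    · intro x hx
      have hx' : x ∈ Ioc 0 a := ⟨hd.trans_lt hx.1, hx.2.le.trans hca⟩
      have p1 := hpos₁ x hx'
      exact mul_pos (sub_pos.2 (Real.rpow_lt_rpow p1.le (hlt x hx) (by linarith)))
        (mul_pos p1 (hpos₂ x hx'))
  obtain ⟨d, hd, hdpos⟩ := exists_pos_right (f := fun x => v₂ x - v₁ x)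
    (h₂.contV.sub h₁.contV) le_rfl ha (by linarith)
  have hlt : ∀ x ∈ Ioc 0 d, u₁ x < u₂ x := by
    intro x hx
    have := lt_of_hasDerivAt_pos (f := fun x => u₂ x - u₁ x) (f' := fun x => v₂ x - v₁ x) hx.1
      ((h₂.contU.sub h₁.contU).mono (Icc_subset_Icc_right (hx.2.trans hd.2)))
      (fun y hy => (h₂.derivU y ⟨hy.1, hy.2.trans_le (hx.2.trans hd.2)⟩).fun_sub
        (h₁.derivU y ⟨hy.1, hy.2.trans_le (hx.2.trans hd.2)⟩))
      (fun y hy => hdpos y ⟨hy.1.le, hy.2.le.trans hx.2⟩)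
    simp only [hu₁, hu₂] at this
    linarith
  have hW0 : W 0 = 0 := by simp [hW, hu₁, hu₂]
  have hWd : W d < 0 := by
    rw [← hW0]
    exact hstep 0 d le_rfl hd.1 hd.2 fun x hx => hlt x ⟨hx.1, hx.2.le⟩
  by_contra! hWa
  obtain ⟨c, hc, hWc0, hWlt⟩ := exists_first_eq (hWc.mono (Icc_subset_Icc_left hd.1.le))
    (right_mem_Icc.2 hd.2) hWa hWd
  have hc0 : 0 < c := hd.1.trans hc.1
  have p1 := hpos₁ c ⟨hc0, hc.2⟩
  have p2 := hpos₂ c ⟨hc0, hc.2⟩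
  -- At the first return `c` of `W` to `0` both logarithmic derivatives equal some `r`, and the
  -- energies read `(r ^ 2 + lam + 2 / (p + 1) * u ^ (p - 1)) * u ^ 2 = v 0 ^ 2`. If `u₂ c ≤ u₁ c`,
  -- the initial slopes would be ordered the wrong way.
  have hcross : u₁ c < u₂ c := by
    by_contra! hle
    have e1 := h₁.energy_zero hp hu₁ ⟨hc0.le, hc.2⟩ p1.le
    have e2 := h₂.energy_zero hp hu₂ ⟨hc0.le, hc.2⟩ p2.le
    have hpow (y : ℝ) (hy : 0 < y) : y ^ (p + 1) = y ^ (p - 1) * y ^ 2 := by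
      rw [← Real.rpow_natCast y 2, ← Real.rpow_add hy]
      congr 1; push_cast; ring
    have hr1 : v₁ c = v₁ c / u₁ c * u₁ c := by field_simp
    have hr2 : v₂ c = v₁ c / u₁ c * u₂ c := by
      have : v₂ c * u₁ c = v₁ c * u₂ c := by simpa [hW, sub_eq_zero] using hWc0
      field_simp
      linarith
    set r := v₁ c / u₁ c
    rw [hpow _ p1, hr1] at e1
    rw [hpow _ p2, hr2] at e2
    set X₁ := r ^ 2 + lam + 2 / (p + 1) * u₁ c ^ (p - 1) with hX₁
    set X₂ := r ^ 2 + lam + 2 / (p + 1) * u₂ c ^ (p - 1) with hX₂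
    have e1' : X₁ * u₁ c ^ 2 = v₁ 0 ^ 2 := by rw [← e1]; ring
    have e2' : X₂ * u₂ c ^ 2 = v₂ 0 ^ 2 := by rw [← e2]; ring
    have hX : X₂ ≤ X₁ := by
      have : u₂ c ^ (p - 1) ≤ u₁ c ^ (p - 1) := Real.rpow_le_rpow p2.le hle (by linarith)
      have := mul_le_mul_of_nonneg_left this (by positivity : 0 ≤ 2 / (p + 1))
      linarith
    have hX1 : 0 < X₁ := by
      by_contra! hneg
      nlinarith [sq_nonneg (u₁ c), pow_pos hv₁ 2]
    have : v₂ 0 ^ 2 ≤ v₁ 0 ^ 2 := by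
      rw [← e1', ← e2']
      calc X₂ * u₂ c ^ 2 ≤ X₁ * u₂ c ^ 2 := mul_le_mul_of_nonneg_right hX (sq_nonneg _)
        _ ≤ X₁ * u₁ c ^ 2 :=
          mul_le_mul_of_nonneg_left (pow_le_pow_left₀ p2.le hle 2) hX1.le
    nlinarith
  -- Since `u₁ < u₂` just before `c`, `W` decreases to `W c = 0`, although it was negative there.
  obtain ⟨e, he, hepos⟩ := exists_pos_left (f := fun x => u₂ x - u₁ x)
    ((h₂.contU.sub h₁.contU).mono (Icc_subset_Icc_left hd.1.le)) hc.1 hc.2 (by linarith)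
  have h1 := hstep e c (hd.1.le.trans he.1) he.2 hc.2 fun x hx => by
    linarith [hepos x ⟨hx.1.le, hx.2.le⟩]
  have h2 := hWlt e he
  linarith

theorem IsTraj.slope_unique {p lam a : ℝ} {u₁ v₁ u₂ v₂ : ℝ → ℝ} (hp : 1 < p) (ha : 0 < a)
    (h₁ : IsTraj p lam 0 a u₁ v₁) (h₂ : IsTraj p lam 0 a u₂ v₂) (hu₁ : u₁ 0 = 0)
    (hu₂ : u₂ 0 = 0) (hv₁ : 0 < v₁ 0) (hv₂ : 0 < v₂ 0)
    (hpos₁ : ∀ x ∈ Ioc 0 a, 0 < u₁ x) (hpos₂ : ∀ x ∈ Ioc 0 a, 0 < u₂ x)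
    (hW : v₂ a * u₁ a = v₁ a * u₂ a) : v₁ 0 = v₂ 0 := by
  rcases lt_trichotomy (v₁ 0) (v₂ 0) with h | h | h
  · have := h₁.wronskian_neg hp ha h₂ hu₁ hu₂ hv₁ h hpos₁ hpos₂
    linarith
  · exact h
  · have := h₂.wronskian_neg hp ha h₁ hu₂ hu₁ hv₂ h hpos₂ hpos₁
    linarith

/-! ### The shooting function: its sign for small and large slopes. -/

/-- The Wronskian of `u` (with derivative `v`) and `mode lam`. -/
noncomputable def modeWronskian (lam : ℝ) (u v : ℝ → ℝ) (x : ℝ) : ℝ :=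
  v x * mode lam x - u x * modeDeriv lam x

theorem IsTraj.continuousOn_modeWronskian {p lam α β : ℝ} {u v : ℝ → ℝ}
    (h : IsTraj p lam α β u v) : ContinuousOn (modeWronskian lam u v) (Icc α β) :=
  (h.contV.mul (continuous_mode_right lam).continuousOn).sub
    (h.contU.mul (continuous_modeDeriv_right lam).continuousOn)

theorem IsTraj.hasDerivAt_modeWronskian {p lam α β : ℝ} {u v : ℝ → ℝ}
    (h : IsTraj p lam α β u v) {x : ℝ} (hx : x ∈ Ioo α β) (hux : 0 ≤ u x) :
    HasDerivAt (modeWronskian lam u v) (-(u x ^ p * mode lam x)) x := by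
  refine (((h.derivV x hx).fun_mul (hasDerivAt_mode lam x)).fun_sub
    ((h.derivU x hx).fun_mul (hasDerivAt_modeDeriv lam x))).congr_deriv ?_
  rw [force_of_nonneg hux]
  ring

/-- The force vanishes below zero. This describes a shot after its first zero and, with `m = 0`, the
shot of slope `0`. -/
theorem isTraj_affine {p lam : ℝ} (hp : 1 < p) {c b m : ℝ} (hm : m ≤ 0) :
    IsTraj p lam c b (fun x => m * (x - c)) (fun _ => m) where
  contU := by fun_prop
  contV := by fun_prop
  derivU x _ := by simpa using ((hasDerivAt_id x).sub_const c).const_mul m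
  derivV x hx := by
    rw [force_of_nonpos hp (mul_nonpos_of_nonpos_of_nonneg hm (sub_nonneg.2 hx.1.le)), neg_zero]
    exact hasDerivAt_const x m

/-- Past its first zero `c` the shot is affine with slope `v c < 0`, so the Wronskian at `a` is `v
c` times the tangent height of `mode_sub_mul_modeDeriv_pos`; at `c` it is `v c * mode lam c`. -/
theorem IsTraj.pos_or_modeWronskian_neg {p lam a : ℝ} {u v : ℝ → ℝ} (hp : 1 < p) (ha : 0 < a)
    (ha2 : a ≤ 1 / 2) (hlam : lam ≤ Real.pi ^ 2) (h : IsTraj p lam 0 a u v) (hu0 : u 0 = 0)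
    (hv0 : 0 < v 0) :
    (∀ x ∈ Ioc 0 a, 0 < u x) ∨ modeWronskian lam u v a < 0 ∧
      ∃ c ∈ Ioc 0 a, (∀ x ∈ Ioo 0 c, 0 < u x) ∧ modeWronskian lam u v c < 0 := by
  rcases h.pos_or_exists_zero hp ha hu0 hv0 with hpos | ⟨c, hc, hpos, huc, hvc⟩
  · exact Or.inl hpos
  have hφc := mode_pos hlam hc.1 (by linarith [hc.2])
  refine Or.inr ⟨?_, c, hc, hpos, ?_⟩
  · have := (h.mono hc.1.le le_rfl).eq_of_eq_left hp (isTraj_affine hp hvc.le)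
      (by simpa using huc) rfl (right_mem_Icc.2 hc.2)
    have hφ := mode_sub_mul_modeDeriv_pos hlam hc.1 hc.2 ha2
    unfold modeWronskian
    rw [this.1, this.2]
    nlinarith
  · unfold modeWronskian
    rw [huc]
    nlinarith

/-- At `π²` the mode vanishes at `0`, so the Wronskian starts from `0` and strictly decreases as
long as the shot is positive. -/
theorem IsTraj.modeWronskian_pi_sq_neg {p a : ℝ} {u v : ℝ → ℝ} (hp : 1 < p) (ha : 0 < a)
    (ha2 : a ≤ 1 / 2) (h : IsTraj p (Real.pi ^ 2) 0 a u v) (hu0 : u 0 = 0) (hv0 : 0 < v 0) :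
    modeWronskian (Real.pi ^ 2) u v a < 0 := by
  rcases h.pos_or_modeWronskian_neg hp ha ha2 le_rfl hu0 hv0 with hpos | hneg
  · have hlt := lt_of_hasDerivAt_pos (f := fun x => -modeWronskian (Real.pi ^ 2) u v x) ha
      h.continuousOn_modeWronskian.neg
      (fun x hx => (h.hasDerivAt_modeWronskian hx (hpos x ⟨hx.1, hx.2.le⟩).le).fun_neg)
      (fun x hx => by
        rw [neg_neg]
        exact mul_pos (Real.rpow_pos_of_pos (hpos x ⟨hx.1, hx.2.le⟩) _)
          (mode_pos le_rfl hx.1 (by linarith [hx.2])))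
    have h0 : modeWronskian (Real.pi ^ 2) u v 0 = 0 := by
      simp [modeWronskian, hu0, mode_pi_sq_zero]
    linarith
  · exact hneg.1

/-- The Wronskian starts at `s * mode lam 0`, linear in `s`, and loses at most a multiple of `s ^ p`
because the shot is of order `s`. -/
theorem IsShooting.eventually_modeWronskian_pos {p a lam : ℝ} {X Y : ℝ → ℝ → ℝ → ℝ} (hp : 1 < p)
    (ha : 0 < a) (ha2 : a ≤ 1 / 2) (hX : IsShooting p a X Y) (hlam : lam < Real.pi ^ 2) :
    ∀ᶠ s in 𝓝[>] 0, 0 < modeWronskian lam (X lam s) (Y lam s) a := by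
  obtain ⟨C, hC, hCb⟩ := hX.dist_le hp |lam| 1
  have hX0 : ∀ x ∈ Icc 0 a, X lam 0 x = 0 := by
    intro x hx
    have := (hX.traj lam 0).eq_of_eq_left hp (isTraj_affine (c := 0) hp le_rfl)
      (by simp [hX.zero_left]) (hX.deriv_left lam 0) hx
    simpa using this.1
  have hXs : ∀ s, 0 < s → s ≤ 1 → ∀ x ∈ Icc 0 a, X lam s x ≤ √C * s := by
    intro s hs hs1 x hx
    have h := hCb lam lam s 0 le_rfl le_rfl (by rwa [abs_of_pos hs]) (by simp) x hx
    rw [hX0 x hx] at h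
    have h2 : X lam s x ^ 2 ≤ (√C * s) ^ 2 := by
      rw [mul_pow, Real.sq_sqrt hC]
      nlinarith [sq_nonneg (Y lam s x - Y lam 0 x)]
    exact (le_abs_self _).trans (abs_le_of_sq_le_sq h2 (mul_nonneg (Real.sqrt_nonneg _) hs.le))
  obtain ⟨Φ, hΦ⟩ := isCompact_Icc.exists_bound_of_continuousOn
    (continuous_mode_right lam).continuousOn (s := Icc (0 : ℝ) 1)
  have hφ0 : 0 < mode lam 0 := mode_pos_of_lt hlam le_rfl zero_le_one
  have hΦ0 : 0 < Φ := hφ0.trans_le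
    ((le_abs_self _).trans (hΦ 0 (left_mem_Icc.2 zero_le_one)))
  have hsmall : ∀ᶠ s : ℝ in 𝓝[>] 0, s ^ (p - 1) * (√C ^ p * Φ) < mode lam 0 := by
    have hc : Continuous fun s : ℝ => s ^ (p - 1) * (√C ^ p * Φ) :=
      (Real.continuous_rpow_const (by linarith)).mul continuous_const
    have ht := hc.tendsto 0
    rw [Real.zero_rpow (by linarith), zero_mul] at ht
    exact (ht.eventually (gt_mem_nhds hφ0)).filter_mono nhdsWithin_le_nhds
  filter_upwards [hsmall, Ioc_mem_nhdsGT (zero_lt_one' ℝ)] with s hs hs1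
  by_contra! hneg
  have htr := hX.traj lam s
  have hs0 : 0 < Y lam s 0 := by rw [hX.deriv_left]; exact hs1.1
  -- `c` ends a stretch of positivity: it is `a`, or a first zero if there is one. Either way the
  -- Wronskian at `c` is nonpositive.
  obtain ⟨c, hc, hpos, hW⟩ : ∃ c ∈ Ioc 0 a, (∀ x ∈ Ioo 0 c, 0 < X lam s x) ∧
      modeWronskian lam (X lam s) (Y lam s) c ≤ 0 := by
    rcases htr.pos_or_modeWronskian_neg hp ha ha2 hlam.le (hX.zero_left _ _) hs0 with
      hpos | ⟨_, c, hc, hpos, hW⟩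
    · exact ⟨a, right_mem_Ioc.2 ha, fun x hx => hpos x ⟨hx.1, hx.2.le⟩, hneg⟩
    · exact ⟨c, hc, hpos, hW.le⟩
  have hm := monotoneOn_of_hasDerivAt_nonneg_off_finite ∅
    (f := fun x => modeWronskian lam (X lam s) (Y lam s) x + (√C * s) ^ p * Φ * x)
    (f' := fun x => -(X lam s x ^ p * mode lam x) + (√C * s) ^ p * Φ)
    (α := 0) (β := c)
    ((htr.continuousOn_modeWronskian.mono (Icc_subset_Icc_right hc.2)).add (by fun_prop))
    (fun x hx _ => by
      refine (htr.hasDerivAt_modeWronskian ⟨hx.1, hx.2.trans_le hc.2⟩ (hpos x hx).le).fun_add ?_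
      simpa using (hasDerivAt_id x).const_mul ((√C * s) ^ p * Φ))
    (fun x hx _ => by
      have h1 : X lam s x ^ p ≤ (√C * s) ^ p :=
        Real.rpow_le_rpow (hpos x hx).le (hXs s hs1.1 hs1.2 x ⟨hx.1.le, hx.2.le.trans hc.2⟩)
          (by linarith)
      have h2 : mode lam x ≤ Φ :=
        (le_abs_self _).trans (hΦ x ⟨hx.1.le, by linarith [hx.2, hc.2]⟩)
      have h3 := mul_le_mul h1 h2 (mode_pos hlam.le hx.1 (by linarith [hx.2, hc.2])).le
        (Real.rpow_nonneg (mul_nonneg (Real.sqrt_nonneg _) hs1.1.le) _)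
      linarith)
  have hm := hm (left_mem_Icc.2 hc.1.le) (right_mem_Icc.2 hc.1.le) hc.1.le
  simp only [modeWronskian, hX.zero_left, hX.deriv_left, mul_zero, zero_mul, add_zero,
    sub_zero] at hm hW
  have hD : (√C * s) ^ p * Φ * c ≤ s * (s ^ (p - 1) * (√C ^ p * Φ)) := by
    have h0 : 0 ≤ (√C * s) ^ p * Φ :=
      mul_nonneg (Real.rpow_nonneg (mul_nonneg (Real.sqrt_nonneg _) hs1.1.le) _) hΦ0.le
    have h1 : (√C * s) ^ p * Φ * c ≤ (√C * s) ^ p * Φ * 1 :=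
      mul_le_mul_of_nonneg_left (by linarith [hc.2]) h0
    rw [Real.mul_rpow (Real.sqrt_nonneg _) hs1.1.le, rpow_eq_rpow_sub_one_mul hp hs1.1.le] at *
    linarith
  have := mul_lt_mul_of_pos_left hs hs1.1
  linarith

/-- A nonnegative Wronskian at `a` keeps the shot positive with `u / mode lam` nondecreasing. Then
`u (a / 2)` cannot be large, by oscillation on `[a / 2, a]`, while a large initial slope would make
it large. -/
theorem exists_modeWronskian_neg_of_lt {p a lam : ℝ} (hp : 1 < p) (ha : 0 < a) (ha2 : a ≤ 1 / 2)
    (hlam : lam < Real.pi ^ 2) : ∃ S : ℝ, ∀ u v : ℝ → ℝ, IsTraj p lam 0 a u v → u 0 = 0 →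
      0 < v 0 → S < v 0 → modeWronskian lam u v a < 0 := by
  obtain ⟨y₁, hy₁, hmin⟩ := isCompact_Icc.exists_isMinOn (nonempty_Icc.2 ha.le)
    (continuous_mode_right lam).continuousOn
  obtain ⟨y₂, hy₂, hmax⟩ := isCompact_Icc.exists_isMaxOn (nonempty_Icc.2 ha.le)
    (continuous_mode_right lam).continuousOn
  have hφ : ∀ x ∈ Icc 0 a, 0 < mode lam x := fun x hx =>
    mode_pos_of_lt hlam hx.1 (by linarith [hx.2])
  set m := mode lam y₁ with hm
  set M := mode lam y₂ with hM
  have hm0 : 0 < m := hφ y₁ hy₁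
  have hM0 : 0 < M := hφ y₂ hy₂
  have hmin' : ∀ x ∈ Icc 0 a, m ≤ mode lam x := fun x hx => hmin hx
  have hmax' : ∀ x ∈ Icc 0 a, mode lam x ≤ M := fun x hx => hmax hx
  set ω := 2 * Real.pi / a with hω
  have hω0 : 0 < ω := div_pos (by linarith [Real.pi_pos]) ha
  -- above the level `Q` the trajectories oscillate faster than `sin (ω x)`
  obtain ⟨Q, hQ⟩ := eventually_atTop.1 ((tendsto_rpow_atTop (y := p - 1)
    (by linarith)).eventually_ge_atTop (ω ^ 2 - lam))
  -- Chosen so that `u (a / 2) ≥ R` forces `u ≥ max Q 0` on `[a / 2, a]`, given the loss of a factor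
  -- `M / m` below.
  set R := M / m * max Q 0 with hR
  have hR0 : 0 ≤ R := by positivity
  set C := |lam| * (M / m * R) + (M / m * R) ^ p with hC
  have hC0 : 0 ≤ C := by positivity
  refine ⟨C + 2 * R / a, fun u v h hu0 hv0 hS => ?_⟩
  by_contra! hW
  have hpos : ∀ x ∈ Ioc 0 a, 0 < u x := by
    rcases h.pos_or_modeWronskian_neg hp ha ha2 hlam.le hu0 hv0 with hpos | hneg
    · exact hpos
    · exact absurd hneg.1 (not_lt.2 hW)
  have hnn : ∀ x ∈ Icc 0 a, 0 ≤ u x := by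
    intro x hx
    rcases hx.1.eq_or_lt with rfl | h0
    · exact hu0.ge
    · exact (hpos x ⟨h0, hx.2⟩).le
  have hWanti : AntitoneOn (modeWronskian lam u v) (Icc 0 a) :=
    antitoneOn_of_hasDerivAt_nonpos_off_finite ∅ h.continuousOn_modeWronskian
      (fun x hx _ => h.hasDerivAt_modeWronskian hx (hnn x (Ioo_subset_Icc_self hx)))
      (fun x hx _ => neg_nonpos.2 (mul_nonneg
        (Real.rpow_nonneg (hnn x (Ioo_subset_Icc_self hx)) _)
        (hφ x (Ioo_subset_Icc_self hx)).le))
  have hWnn : ∀ x ∈ Icc 0 a, 0 ≤ modeWronskian lam u v x := fun x hx =>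
    hW.trans (hWanti hx (right_mem_Icc.2 ha.le) hx.2)
  have hratio : MonotoneOn (fun x => u x / mode lam x) (Icc 0 a) := by
    refine monotoneOn_of_hasDerivAt_nonneg_off_finite ∅
      (f' := fun x => modeWronskian lam u v x / mode lam x ^ 2)
      (h.contU.div (continuous_mode_right lam).continuousOn fun x hx => (hφ x hx).ne')
      (fun x hx _ => (h.derivU x hx).fun_div (hasDerivAt_mode lam x)
        (hφ x (Ioo_subset_Icc_self hx)).ne')
      (fun x hx _ => div_nonneg (hWnn x (Ioo_subset_Icc_self hx)) (sq_nonneg _))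
  have hharnack : ∀ x ∈ Icc 0 a, ∀ y ∈ Icc 0 a, x ≤ y → u x ≤ M / m * u y := by
    intro x hx y hy hxy
    have h1 := hratio hx hy hxy
    calc u x = u x / mode lam x * mode lam x := by rw [div_mul_cancel₀ _ (hφ x hx).ne']
      _ ≤ u y / mode lam y * mode lam x := mul_le_mul_of_nonneg_right h1 (hφ x hx).le
      _ ≤ u y / m * M := by
        refine mul_le_mul ?_ (hmax' x hx) (hφ x hx).le (div_nonneg (hnn y hy) hm0.le)
        exact div_le_div_of_nonneg_left (hnn y hy) hm0 (hmin' y hy)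
      _ = _ := by ring
  have hmid : a / 2 ∈ Icc 0 a := ⟨by linarith, by linarith⟩
  have huR : u (a / 2) < R := by
    by_contra! hRu
    have hQu : ∀ x ∈ Icc (a / 2) a, ω ^ 2 - lam ≤ u x ^ (p - 1) := by
      intro x hx
      have h1 := hharnack _ hmid x ⟨hmid.1.trans hx.1, hx.2⟩ hx.1
      refine hQ _ ((le_max_left Q 0).trans ?_)
      exact le_of_mul_le_mul_left (hRu.trans h1) (div_pos hM0 hm0)
    have hd (x : ℝ) : HasDerivAt (fun x => ω * (x - a / 2)) ω x := by
      simpa using ((hasDerivAt_id x).sub_const (a / 2)).const_mul ω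
    -- Sturm comparison with `sin (ω * (x - a / 2))`, whose half period is `a / 2`: the Wronskian
    -- would have to decrease from `-ω * u (a / 2) ≤ 0` to `ω * u a > 0`.
    have hanti : AntitoneOn (fun x => v x * Real.sin (ω * (x - a / 2)) -
        u x * (ω * Real.cos (ω * (x - a / 2)))) (Icc (a / 2) a) := by
      refine antitoneOn_of_hasDerivAt_nonpos_off_finite ∅
        (f' := fun x => (ω ^ 2 - lam - u x ^ (p - 1)) * (u x * Real.sin (ω * (x - a / 2)))) ?_ ?_ ?_
      · exact ((h.contV.mono (Icc_subset_Icc_left hmid.1)).mul (by fun_prop)).sub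
          ((h.contU.mono (Icc_subset_Icc_left hmid.1)).mul (by fun_prop))
      · intro x hx _
        have hx' : x ∈ Ioo 0 a := ⟨hmid.1.trans_lt hx.1, hx.2⟩
        refine (((h.derivV x hx').fun_mul (hd x).sin).fun_sub
          ((h.derivU x hx').fun_mul ((hd x).cos.const_mul ω))).congr_deriv ?_
        rw [force_of_nonneg (hnn x (Ioo_subset_Icc_self hx')), rpow_eq_rpow_sub_one_mul hp
          (hnn x (Ioo_subset_Icc_self hx'))]
        ring
      · intro x hx _
        have hx' : x ∈ Icc 0 a := ⟨hmid.1.trans hx.1.le, hx.2.le⟩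
        refine mul_nonpos_of_nonpos_of_nonneg
          (by linarith [hQu x (Ioo_subset_Icc_self hx)]) (mul_nonneg (hnn x hx') ?_)
        refine Real.sin_nonneg_of_nonneg_of_le_pi
          (mul_nonneg hω0.le (by linarith [hx.1])) ?_
        have : ω * (a / 2) = Real.pi := by rw [hω]; field_simp
        rw [← this]
        exact mul_le_mul_of_nonneg_left (by linarith [hx.2]) hω0.le
    have h1 := hanti (left_mem_Icc.2 hmid.2) (right_mem_Icc.2 hmid.2) hmid.2
    have e : ω * (a - a / 2) = Real.pi := by rw [hω]; field_simp; ring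
    simp only [e, sub_self, mul_zero, Real.sin_zero, Real.cos_zero, Real.sin_pi,
      Real.cos_pi] at h1
    have h2 := mul_pos (hpos a (right_mem_Ioc.2 ha)) hω0
    have h3 := mul_nonneg (hnn _ hmid) hω0.le
    linarith
  -- Now `u` is bounded on `[0, a / 2]`, so `v ≥ v 0 - C` there, and integration bounds `v 0` by `C
  -- + 2 * R / a`.
  have huK : ∀ x ∈ Icc 0 (a / 2), u x ≤ M / m * R := fun x hx =>
    (hharnack x ⟨hx.1, hx.2.trans hmid.2⟩ _ hmid hx.2).trans
      (mul_le_mul_of_nonneg_left huR.le (by positivity))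
  have hvmono : MonotoneOn (fun x => v x + C * x) (Icc 0 (a / 2)) := by
    refine monotoneOn_of_hasDerivAt_nonneg_off_finite ∅
      (f' := fun x => -force p lam (u x) + C)
      ((h.contV.mono (Icc_subset_Icc_right hmid.2)).add (by fun_prop)) ?_ ?_
    · intro x hx _
      refine (h.derivV x ⟨hx.1, hx.2.trans_le hmid.2⟩).fun_add ?_
      simpa using (hasDerivAt_id x).const_mul C
    · intro x hx _
      have h0 := hnn x ⟨hx.1.le, hx.2.le.trans hmid.2⟩
      have h1 := huK x (Ioo_subset_Icc_self hx)
      rw [force_of_nonneg h0]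
      have h2 : u x ^ p ≤ (M / m * R) ^ p := Real.rpow_le_rpow h0 h1 (by linarith)
      have h3 : lam * u x ≤ |lam| * (M / m * R) :=
        mul_le_mul (le_abs_self _) h1 h0 (abs_nonneg _)
      linarith
  have humono : MonotoneOn (fun x => u x - (v 0 - C) * x) (Icc 0 (a / 2)) := by
    refine monotoneOn_of_hasDerivAt_nonneg_off_finite ∅
      (f' := fun x => v x - (v 0 - C))
      ((h.contU.mono (Icc_subset_Icc_right hmid.2)).sub (by fun_prop)) ?_ ?_
    · intro x hx _
      refine (h.derivU x ⟨hx.1, hx.2.trans_le hmid.2⟩).fun_sub ?_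
      simpa using (hasDerivAt_id x).const_mul (v 0 - C)
    · intro x hx _
      have h1 := hvmono (left_mem_Icc.2 hmid.1) (Ioo_subset_Icc_self hx) hx.1.le
      simp only [mul_zero, add_zero] at h1
      have h2 : C * x ≤ C * 1 := mul_le_mul_of_nonneg_left (by linarith [hx.2]) hC0
      linarith
  have h1 := humono (left_mem_Icc.2 hmid.1) (right_mem_Icc.2 hmid.1) hmid.1
  simp only [hu0, mul_zero, sub_zero] at h1
  have h2 : 2 * R / a < v 0 - C := by linarith
  rw [div_lt_iff₀ ha] at h2
  linarith

/-! ### The matching slope and its continuity in `lam`. -/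

section

variable {p a : ℝ} {X Y : ℝ → ℝ → ℝ → ℝ}

theorem IsShooting.continuous_modeWronskian (hp : 1 < p) (ha : 0 < a) (hX : IsShooting p a X Y) :
    Continuous fun q : ℝ × ℝ => modeWronskian q.1 (X q.1 q.2) (Y q.1 q.2) a := by
  have h : Continuous fun q : ℝ × ℝ => (X q.1 q.2 a, Y q.1 q.2 a) := by
    have hc : Continuous fun q : ℝ × ℝ => (q.1, q.2, a) := by fun_prop
    exact (hX.continuousOn hp).comp_continuous hc fun q => right_mem_Icc.2 ha.le
  have hc : Continuous fun q : ℝ × ℝ => (q.1, a) := by fun_prop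
  have h1 : Continuous fun q : ℝ × ℝ => mode q.1 a := continuous_mode.comp hc
  have h2 : Continuous fun q : ℝ × ℝ => modeDeriv q.1 a := continuous_modeDeriv.comp hc
  exact ((continuous_snd.comp h).mul h1).sub ((continuous_fst.comp h).mul h2)

/-- Both shots are positive and share the logarithmic derivative of `mode lam` at `a`. -/
theorem IsTraj.slope_unique_of_modeWronskian {lam : ℝ} {u₁ v₁ u₂ v₂ : ℝ → ℝ} (hp : 1 < p)
    (ha : 0 < a) (ha2 : a ≤ 1 / 2) (hlam : lam ≤ Real.pi ^ 2) (h₁ : IsTraj p lam 0 a u₁ v₁)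
    (h₂ : IsTraj p lam 0 a u₂ v₂) (hu₁ : u₁ 0 = 0) (hu₂ : u₂ 0 = 0) (hv₁ : 0 < v₁ 0)
    (hv₂ : 0 < v₂ 0) (hW₁ : modeWronskian lam u₁ v₁ a = 0) (hW₂ : modeWronskian lam u₂ v₂ a = 0) :
    v₁ 0 = v₂ 0 := by
  have hpos : ∀ u v : ℝ → ℝ, IsTraj p lam 0 a u v → u 0 = 0 → 0 < v 0 →
      modeWronskian lam u v a = 0 → ∀ x ∈ Ioc 0 a, 0 < u x := by
    intro u v h hu hv hW
    rcases h.pos_or_modeWronskian_neg hp ha ha2 hlam hu hv with hpos | hneg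
    · exact hpos
    · exact absurd hW hneg.1.ne
  refine h₁.slope_unique hp ha h₂ hu₁ hu₂ hv₁ hv₂ (hpos _ _ h₁ hu₁ hv₁ hW₁)
    (hpos _ _ h₂ hu₂ hv₂ hW₂) ?_
  have hφ := mode_pos hlam ha (by linarith)
  unfold modeWronskian at hW₁ hW₂
  refine mul_right_cancel₀ hφ.ne' ?_
  linear_combination u₁ a * hW₂ - u₂ a * hW₁

theorem IsShooting.exists_slope_of_lt (hp : 1 < p) (ha : 0 < a) (ha2 : a ≤ 1 / 2)
    (hX : IsShooting p a X Y) {lam : ℝ} (hlam : lam < Real.pi ^ 2) :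
    ∃ s, 0 < s ∧ modeWronskian lam (X lam s) (Y lam s) a = 0 ∧
      (∀ t, 0 < t → t < s → 0 < modeWronskian lam (X lam t) (Y lam t) a) ∧
      ∀ t, s < t → modeWronskian lam (X lam t) (Y lam t) a < 0 := by
  set G : ℝ → ℝ := fun s => modeWronskian lam (X lam s) (Y lam s) a with hG
  have hGc : Continuous G :=
    (hX.continuous_modeWronskian hp ha).comp (Continuous.prodMk_right lam)
  have hsmall := hX.eventually_modeWronskian_pos hp ha ha2 hlam
  have hsmall' : ∀ r : ℝ, 0 < r → ∃ t, 0 < t ∧ t < r ∧ 0 < G t := by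
    intro r hr
    obtain ⟨t, h1, h2⟩ := (hsmall.and (Ioo_mem_nhdsGT hr)).exists
    exact ⟨t, h2.1, h2.2, h1⟩
  obtain ⟨S, hS⟩ := exists_modeWronskian_neg_of_lt hp ha ha2 hlam
  have hlarge : ∀ s, 0 < s → S < s → G s < 0 := fun s hs hSs =>
    hS _ _ (hX.traj lam s) (hX.zero_left _ _) (by rwa [hX.deriv_left]) (by rwa [hX.deriv_left])
  have huniq : ∀ s t, 0 < s → 0 < t → G s = 0 → G t = 0 → s = t := by
    intro s t hs ht hGs hGt
    have := (hX.traj lam s).slope_unique_of_modeWronskian hp ha ha2 hlam.le (hX.traj lam t)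
      (hX.zero_left _ _) (hX.zero_left _ _) (by rwa [hX.deriv_left]) (by rwa [hX.deriv_left])
      hGs hGt
    rwa [hX.deriv_left, hX.deriv_left] at this
  have hroot : ∀ r q, 0 < r → r ≤ q → 0 ≤ G r → G q ≤ 0 → ∃ s ∈ Icc r q, G s = 0 := by
    intro r q _ hrq hr hq
    exact intermediate_value_Icc' hrq hGc.continuousOn ⟨hq, hr⟩
  obtain ⟨t₀, ht₀, -, hGt₀⟩ := hsmall' 1 one_pos
  obtain ⟨s, hs, hGs⟩ := hroot t₀ (max t₀ (S + 1)) ht₀ (le_max_left _ _) hGt₀.le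
    (hlarge _ (ht₀.trans_le (le_max_left _ _))
      (lt_of_lt_of_le (lt_add_one S) (le_max_right _ _))).le
  have hs0 : 0 < s := ht₀.trans_le hs.1
  refine ⟨s, hs0, hGs, fun t ht hts => ?_, fun t hst => ?_⟩
  · by_contra! hneg
    obtain ⟨r, hr, hrt, hGr⟩ := hsmall' t ht
    obtain ⟨q, hq, hGq⟩ := hroot r t hr hrt.le hGr.le hneg
    have := huniq q s (hr.trans_le hq.1) hs0 hGq hGs
    linarith [hq.2]
  · by_contra! hpos
    obtain ⟨q, hq, hGq⟩ := hroot t (max t (S + 1)) (hs0.trans hst) (le_max_left _ _) hpos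
      (hlarge _ ((hs0.trans hst).trans_le (le_max_left _ _))
        (lt_of_lt_of_le (lt_add_one S) (le_max_right _ _))).le
    have := huniq q s ((hs0.trans hst).trans_le hq.1) hs0 hGq hGs
    linarith [hq.1]

/-- Continuity comes from the signs on both sides of the root: a strict sign at a fixed test slope
persists for nearby `lam` and keeps `σ` on one side of it. At `π²` only the upper sign is available;
`0 ≤ σ` replaces the lower one. -/
theorem IsShooting.exists_slope (hp : 1 < p) (ha : 0 < a) (ha2 : a ≤ 1 / 2)
    (hX : IsShooting p a X Y) :
    ∃ σ : ℝ → ℝ, ContinuousOn σ (Iic (Real.pi ^ 2)) ∧ σ (Real.pi ^ 2) = 0 ∧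
      ∀ lam < Real.pi ^ 2, 0 < σ lam ∧
        modeWronskian lam (X lam (σ lam)) (Y lam (σ lam)) a = 0 := by
  have hex : ∀ lam : ℝ, ∃ s, (lam < Real.pi ^ 2 → 0 < s ∧
      modeWronskian lam (X lam s) (Y lam s) a = 0 ∧
      ∀ t, 0 < t → t < s → 0 < modeWronskian lam (X lam t) (Y lam t) a) ∧
      (Real.pi ^ 2 ≤ lam → s = 0) ∧ (lam ≤ Real.pi ^ 2 → ∀ t, s < t →
        modeWronskian lam (X lam t) (Y lam t) a < 0) := by
    intro lam
    rcases lt_or_ge lam (Real.pi ^ 2) with hlam | hlam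
    · obtain ⟨s, h0, h1, h2, h3⟩ := hX.exists_slope_of_lt hp ha ha2 hlam
      exact ⟨s, fun _ => ⟨h0, h1, h2⟩, fun h => absurd hlam (not_lt.2 h), fun _ => h3⟩
    · refine ⟨0, fun h => absurd h (not_lt.2 hlam), fun _ => rfl, fun h t ht => ?_⟩
      obtain rfl := le_antisymm h hlam
      exact (hX.traj _ t).modeWronskian_pi_sq_neg hp ha ha2 (hX.zero_left _ _)
        (by rwa [hX.deriv_left])
  choose σ hσ1 hσ2 hσ3 using hex
  refine ⟨σ, ?_, hσ2 _ le_rfl, fun lam hlam => ⟨(hσ1 lam hlam).1, (hσ1 lam hlam).2.1⟩⟩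
  have hnn : ∀ lam, 0 ≤ σ lam := by
    intro lam
    rcases lt_or_ge lam (Real.pi ^ 2) with hlam | hlam
    · exact (hσ1 lam hlam).1.le
    · exact (hσ2 lam hlam).ge
  have hGc := hX.continuous_modeWronskian hp ha
  intro lam₀ hlam₀
  refine tendsto_order.2 ⟨fun b hb => ?_, fun b hb => ?_⟩
  · rcases (mem_Iic.1 hlam₀).lt_or_eq with hlt | rfl
    · obtain ⟨h0, -, h2⟩ := hσ1 lam₀ hlt
      -- The test slope must be positive, as the sign below the root is known only there.
      set b' := max b (σ lam₀ / 2)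
      have hb'0 : 0 < b' := lt_max_of_lt_right (by linarith)
      have hG := h2 b' hb'0 (max_lt hb (by linarith))
      have hev := (hGc.comp (Continuous.prodMk_left b')).tendsto lam₀ |>.eventually
        (lt_mem_nhds hG)
      filter_upwards [mem_nhdsWithin_of_mem_nhds hev, self_mem_nhdsWithin] with lam h hlam
      by_contra! hle
      have hle' : σ lam ≤ b' := hle.trans (le_max_left _ _)
      rcases hle'.lt_or_eq with h' | h'
      · exact absurd h (not_lt.2 (hσ3 lam hlam b' h').le)
      · rcases (mem_Iic.1 hlam).lt_or_eq with h'' | rfl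
        · have := (hσ1 lam h'').2.1
          rw [h'] at this
          exact absurd h (by simp [Function.comp, this])
        · rw [hσ2 _ le_rfl] at h'
          exact absurd h' hb'0.ne
    · rw [hσ2 _ le_rfl] at hb
      exact Eventually.of_forall fun lam => hb.trans_le (hnn lam)
  · have hb0 : 0 < b := (hnn lam₀).trans_lt hb
    have hG := hσ3 lam₀ hlam₀ b hb
    have hev := (hGc.comp (Continuous.prodMk_left b)).tendsto lam₀ |>.eventually (gt_mem_nhds hG)
    filter_upwards [mem_nhdsWithin_of_mem_nhds hev, self_mem_nhdsWithin] with lam h hlam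
    by_contra! hle
    rcases (mem_Iic.1 hlam).lt_or_eq with hlt | rfl
    · rcases hle.lt_or_eq with h' | h'
      · exact absurd h (not_lt.2 ((hσ1 lam hlt).2.2 b hb0 h').le)
      · have := (hσ1 lam hlt).2.1
        rw [← h'] at this
        exact absurd h (by simp [Function.comp, this])
    · rw [hσ2 _ le_rfl] at hle
      linarith

end

/-! ### Gluing a shot to a symmetric solution. -/

/-- Near `x₀`, `f y - (g x₀ + ε) * y` is antitone and `f y - (g x₀ - ε) * y` is monotone,
exceptional points included; this squeezes the difference quotient. -/
theorem hasDerivWithinAt_of_continuousOn_of_off_finite {f g : ℝ → ℝ} {α β : ℝ} (S : Finset ℝ)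
    (hf : ContinuousOn f (Icc α β)) (hg : ContinuousOn g (Icc α β))
    (hd : ∀ x ∈ Ioo α β, x ∉ S → HasDerivAt f (g x) x) {x₀ : ℝ} (hx₀ : x₀ ∈ Icc α β) :
    HasDerivWithinAt f (g x₀) (Icc α β) x₀ := by
  rw [hasDerivWithinAt_iff_isLittleO, Asymptotics.isLittleO_iff]
  intro ε hε
  obtain ⟨δ, hδ, h⟩ := Metric.continuousOn_iff.1 hg x₀ hx₀ ε hε
  have hloc : ∀ α' β', α ≤ α' → β' ≤ β → x₀ - δ < α' → β' < x₀ + δ → α' ≤ β' →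
      |f β' - f α' - g x₀ * (β' - α')| ≤ ε * (β' - α') := by
    intro α' β' hα hβ h1 h2 hle
    have hsub : Icc α' β' ⊆ Icc α β := Icc_subset_Icc hα hβ
    have hd' (k : ℝ) : ∀ x ∈ Ioo α' β', x ∉ S →
        HasDerivAt (fun y => f y - k * y) (g x - k) x := by
      intro x hx hxS
      refine (hd x (Ioo_subset_Ioo hα hβ hx) hxS).fun_sub ?_
      simpa using (hasDerivAt_id x).const_mul k
    have hb : ∀ x ∈ Ioo α' β', |g x - g x₀| < ε := fun x hx => by
      rw [← Real.dist_eq]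
      refine h x (hsub (Ioo_subset_Icc_self hx)) ?_
      rw [Real.dist_eq, abs_lt]
      exact ⟨by linarith [hx.1], by linarith [hx.2]⟩
    have ha := antitoneOn_of_hasDerivAt_nonpos_off_finite S
      ((hf.mono hsub).sub (by fun_prop)) (hd' (g x₀ + ε))
      (fun x hx _ => by linarith [(abs_lt.1 (hb x hx)).2])
      (left_mem_Icc.2 hle) (right_mem_Icc.2 hle) hle
    have hm := monotoneOn_of_hasDerivAt_nonneg_off_finite S
      ((hf.mono hsub).sub (by fun_prop)) (hd' (g x₀ - ε))
      (fun x hx _ => by linarith [(abs_lt.1 (hb x hx)).1])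
      (left_mem_Icc.2 hle) (right_mem_Icc.2 hle) hle
    simp only [Pi.sub_apply] at ha hm
    rw [abs_le]
    constructor <;> linarith
  filter_upwards [self_mem_nhdsWithin,
    mem_nhdsWithin_of_mem_nhds (Ioo_mem_nhds (show x₀ - δ < x₀ by linarith)
      (show x₀ < x₀ + δ by linarith))] with x hx hxδ
  simp only [Real.norm_eq_abs, smul_eq_mul]
  rcases le_total x₀ x with hle | hle
  · have := hloc x₀ x hx₀.1 hx.2 (by linarith) hxδ.2 hle
    rwa [abs_of_nonneg (sub_nonneg.2 hle), mul_comm (x - x₀)]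
  · have := hloc x x₀ hx.1 hx₀.2 hxδ.1 (by linarith) hle
    rw [abs_of_nonpos (sub_nonpos.2 hle), neg_sub]
    rwa [← abs_neg, show -(f x - f x₀ - (x - x₀) * g x₀) = f x₀ - f x - g x₀ * (x₀ - x) by ring]

theorem modeDeriv_one_sub (lam x : ℝ) : modeDeriv lam (1 - x) = -modeDeriv lam x := by
  unfold modeDeriv
  rw [show (1 - x - 1 / 2 : ℝ) = -(x - 1 / 2) by ring, mul_neg, mul_neg, Real.cos_neg,
    Real.cosh_neg, Real.sin_neg, Real.sinh_neg]
  ring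

/-- The function equal to `u` on `[0, a]`, proportional to `mode lam` on `[a, 1 - a]`, and
symmetric about `1 / 2`. -/
noncomputable def profile (lam a : ℝ) (u : ℝ → ℝ) (x : ℝ) : ℝ :=
  u (min (min x (1 - x)) a) * (mode lam (max (min x (1 - x)) a) / mode lam a)

/-- The derivative of `profile`. -/
noncomputable def profileDeriv (lam a : ℝ) (u v : ℝ → ℝ) (x : ℝ) : ℝ :=
  v (min x a) - v a + u a / mode lam a * modeDeriv lam (max a (min x (1 - a))) -
    (v (min (1 - x) a) - v a)

theorem profile_one_sub (lam a : ℝ) (u : ℝ → ℝ) (x : ℝ) :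
    profile lam a u (1 - x) = profile lam a u x := by
  unfold profile
  rw [sub_sub_cancel, min_comm (1 - x) x]

section Profile

variable {p lam a : ℝ} {u v : ℝ → ℝ}

theorem profile_of_le (hφ : mode lam a ≠ 0) (ha : a ≤ 1 / 2) {x : ℝ} (hx : x ≤ a) :
    profile lam a u x = u x := by
  unfold profile
  rw [min_eq_left (by linarith : x ≤ 1 - x), min_eq_left hx, max_eq_right hx, div_self hφ, mul_one]

theorem profile_of_ge (hφ : mode lam a ≠ 0) (ha : a ≤ 1 / 2) {x : ℝ} (hx : 1 - a ≤ x) :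
    profile lam a u x = u (1 - x) := by
  rw [← profile_one_sub, profile_of_le hφ ha (by linarith)]

theorem profile_of_mem {x : ℝ} (hx : x ∈ Icc a (1 - a)) :
    profile lam a u x = u a / mode lam a * mode lam x := by
  have hm : a ≤ min x (1 - x) := le_min hx.1 (by linarith [hx.2])
  unfold profile
  rw [min_eq_right hm, max_eq_left hm]
  rcases min_choice x (1 - x) with h | h
  · rw [h]; ring
  · rw [h, mode_one_sub]; ring

theorem continuousOn_profile (ha : 0 < a) (h : IsTraj p lam 0 a u v) :
    ContinuousOn (profile lam a u) (Icc 0 1) := by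
  refine ContinuousOn.mul ?_ ?_
  · refine h.contU.comp (by fun_prop) fun x hx => ⟨le_min (le_min hx.1 ?_) ha.le, min_le_right _ _⟩
    linarith [hx.2]
  · refine ContinuousOn.div_const ?_ _
    exact (continuous_mode_right lam).comp_continuousOn (by fun_prop)

/-- The telescoping `min`/`max` form of `profileDeriv` gives continuity summand by summand, without
any matching condition. -/
theorem continuousOn_profileDeriv (ha : 0 < a) (h : IsTraj p lam 0 a u v) :
    ContinuousOn (profileDeriv lam a u v) (Icc 0 1) := by
  refine ContinuousOn.sub (ContinuousOn.add (ContinuousOn.sub ?_ continuousOn_const) ?_)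
    (ContinuousOn.sub ?_ continuousOn_const)
  · exact h.contV.comp (by fun_prop) fun x hx => ⟨le_min hx.1 ha.le, min_le_right _ _⟩
  · exact continuousOn_const.mul
      ((continuous_modeDeriv_right lam).comp_continuousOn (by fun_prop))
  · refine h.contV.comp (by fun_prop) fun x hx => ⟨le_min ?_ ha.le, min_le_right _ _⟩
    linarith [hx.2]

/-- The vanishing Wronskian says that `u a / mode lam a * modeDeriv lam a` cancels `v a`: this is
the `C¹` matching. -/
theorem profileDeriv_of_le (hφ : mode lam a ≠ 0) (ha : a ≤ 1 / 2)
    (hW : modeWronskian lam u v a = 0) {x : ℝ} (hx : x ≤ a) :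
    profileDeriv lam a u v x = v x := by
  unfold profileDeriv
  rw [min_eq_left hx, min_eq_left (by linarith : x ≤ 1 - a), max_eq_left hx,
    min_eq_right (by linarith : a ≤ 1 - x)]
  unfold modeWronskian at hW
  field_simp
  linarith

theorem profileDeriv_of_mem {x : ℝ} (hx : x ∈ Icc a (1 - a)) :
    profileDeriv lam a u v x = u a / mode lam a * modeDeriv lam x := by
  unfold profileDeriv
  rw [min_eq_right hx.1, min_eq_left hx.2, max_eq_right hx.1,
    min_eq_right (by linarith [hx.2] : a ≤ 1 - x)]
  ring

theorem profileDeriv_of_ge (hφ : mode lam a ≠ 0) (ha : a ≤ 1 / 2)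
    (hW : modeWronskian lam u v a = 0) {x : ℝ} (hx : 1 - a ≤ x) :
    profileDeriv lam a u v x = -v (1 - x) := by
  unfold profileDeriv
  rw [min_eq_right (by linarith : a ≤ x), min_eq_right hx,
    max_eq_right (by linarith : a ≤ 1 - a), min_eq_left (by linarith : 1 - x ≤ a),
    modeDeriv_one_sub]
  unfold modeWronskian at hW
  field_simp
  linarith

theorem hasDerivAt_profile (hφ : mode lam a ≠ 0) (ha2 : a ≤ 1 / 2)
    (h : IsTraj p lam 0 a u v) (hW : modeWronskian lam u v a = 0) {x : ℝ} (hx : x ∈ Ioo 0 1)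
    (hxa : x ≠ a) (hxb : x ≠ 1 - a) :
    HasDerivAt (profile lam a u) (profileDeriv lam a u v x) x := by
  rcases lt_or_gt_of_ne hxa with hlt | hgt
  · rw [profileDeriv_of_le hφ ha2 hW hlt.le]
    refine (h.derivU x ⟨hx.1, hlt⟩).congr_of_eventuallyEq ?_
    filter_upwards [gt_mem_nhds hlt] with y hy using profile_of_le hφ ha2 (le_of_lt hy)
  · rcases lt_or_gt_of_ne hxb with hlt' | hgt'
    · rw [profileDeriv_of_mem ⟨hgt.le, hlt'.le⟩]
      refine ((hasDerivAt_mode lam x).const_mul (u a / mode lam a)).congr_of_eventuallyEq ?_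
      filter_upwards [Icc_mem_nhds hgt hlt'] with y hy using profile_of_mem hy
    · rw [profileDeriv_of_ge hφ ha2 hW hgt'.le]
      refine HasDerivAt.congr_of_eventuallyEq (f := fun y => u (1 - y)) ?_ ?_
      · exact (h.derivU (1 - x) ⟨by linarith [hx.2], by linarith⟩).comp_const_sub 1 x
      · filter_upwards [lt_mem_nhds hgt'] with y hy using profile_of_ge hφ ha2 (le_of_lt hy)

theorem hasDerivAt_profileDeriv {h : ℝ} (hφ : mode lam ((1 - h) / 2) ≠ 0) (hh0 : 0 < h)
    (ht : IsTraj p lam 0 ((1 - h) / 2) u v)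
    (hW : modeWronskian lam u v ((1 - h) / 2) = 0)
    (hnn : ∀ x ∈ Icc 0 ((1 - h) / 2), 0 ≤ u x) {x : ℝ} (hx : x ∈ Ioo 0 1)
    (hxa : x ≠ (1 - h) / 2) (hxb : x ≠ (1 + h) / 2) :
    HasDerivAt (profileDeriv lam ((1 - h) / 2) u v)
      (-(lam * profile lam ((1 - h) / 2) u x +
        weight h x * profile lam ((1 - h) / 2) u x ^ p)) x := by
  have ha2 : (1 - h) / 2 ≤ 1 / 2 := by linarith
  have hb : (1 + h) / 2 = 1 - (1 - h) / 2 := by ring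
  rcases lt_or_gt_of_ne hxa with hlt | hgt
  · have hw : weight h x = 1 := by
      unfold weight
      rw [if_neg fun hm => absurd hm.1 (not_lt.2 hlt.le)]
    rw [profile_of_le hφ ha2 hlt.le, hw, one_mul, ← force_of_nonneg (hnn x ⟨hx.1.le, hlt.le⟩)]
    refine (ht.derivV x ⟨hx.1, hlt⟩).congr_of_eventuallyEq ?_
    filter_upwards [gt_mem_nhds hlt] with y hy using profileDeriv_of_le hφ ha2 hW (le_of_lt hy)
  · rcases lt_or_gt_of_ne hxb with hlt' | hgt'
    · have hw : weight h x = 0 := by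
        unfold weight
        rw [if_pos ⟨hgt, hlt'⟩]
      rw [hb] at hlt'
      rw [profile_of_mem ⟨hgt.le, hlt'.le⟩, hw, zero_mul, add_zero]
      refine (((hasDerivAt_modeDeriv lam x).const_mul (u ((1 - h) / 2) /
        mode lam ((1 - h) / 2))).congr_of_eventuallyEq ?_).congr_deriv (by ring)
      filter_upwards [Icc_mem_nhds hgt hlt'] with y hy using profileDeriv_of_mem hy
    · have hw : weight h x = 1 := by
        unfold weight
        rw [if_neg fun hm => absurd hm.2 (not_lt.2 hgt'.le)]
      rw [hb] at hgt'
      have hx' : 1 - x ∈ Ioo 0 ((1 - h) / 2) := ⟨by linarith [hx.2], by linarith⟩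
      rw [profile_of_ge hφ ha2 hgt'.le, hw, one_mul,
        ← force_of_nonneg (hnn _ (Ioo_subset_Icc_self hx'))]
      refine HasDerivAt.congr_of_eventuallyEq (f := fun y => -v (1 - y)) ?_ ?_
      · have := ((ht.derivV (1 - x) hx').comp_const_sub 1 x).fun_neg
        simpa using this
      · filter_upwards [lt_mem_nhds hgt'] with y hy using profileDeriv_of_ge hφ ha2 hW (le_of_lt hy)

theorem profile_nonneg (hlam : lam ≤ Real.pi ^ 2) (ha : 0 < a) (ha2 : a ≤ 1 / 2)
    (hnn : ∀ x ∈ Icc 0 a, 0 ≤ u x) {x : ℝ} (hx : x ∈ Icc (0 : ℝ) 1) : 0 ≤ profile lam a u x := by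
  refine mul_nonneg (hnn _ ⟨le_min (le_min hx.1 (by linarith [hx.2])) ha.le, min_le_right _ _⟩)
    (div_nonneg ?_ (mode_pos hlam ha (by linarith)).le)
  refine (mode_pos hlam (lt_max_of_lt_right ha) (max_lt ?_ (by linarith))).le
  rcases le_total x (1 / 2) with h | h
  · exact (min_le_left _ _).trans_lt (by linarith)
  · exact (min_le_right _ _).trans_lt (by linarith)

end Profile

theorem extendI_of_mem {w : C(unitInterval, ℝ)} {x : ℝ} (hx : x ∈ Icc (0 : ℝ) 1) :
    extendI w x = w ⟨x, hx⟩ := IccExtend_of_mem _ _ hx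

theorem continuous_extendI (w : C(unitInterval, ℝ)) : Continuous (extendI w) :=
  w.continuous.Icc_extend'

theorem isSymmetricPositiveSolution_of_profile {p h lam : ℝ} {u v : ℝ → ℝ} (hh0 : 0 < h)
    (hh1 : h < 1) (hlam : lam ≤ Real.pi ^ 2) (ht : IsTraj p lam 0 ((1 - h) / 2) u v)
    (hu0 : u 0 = 0) (hpos : ∀ x ∈ Ioc 0 ((1 - h) / 2), 0 < u x)
    (hW : modeWronskian lam u v ((1 - h) / 2) = 0) {w : C(unitInterval, ℝ)}
    (hw : ∀ x : unitInterval, w x = profile lam ((1 - h) / 2) u x) :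
    IsSymmetricPositiveSolution p h lam w := by
  have ha : 0 < (1 - h) / 2 := by linarith
  have ha2 : (1 - h) / 2 ≤ 1 / 2 := by linarith
  have hb : (1 + h) / 2 = 1 - (1 - h) / 2 := by ring
  have hφ : mode lam ((1 - h) / 2) ≠ 0 := (mode_pos hlam ha (by linarith)).ne'
  have hnn : ∀ x ∈ Icc 0 ((1 - h) / 2), 0 ≤ u x := by
    intro x hx
    rcases hx.1.eq_or_lt with rfl | h0
    · exact hu0.ge
    · exact (hpos x ⟨h0, hx.2⟩).le
  have hext : ∀ x ∈ Icc (0 : ℝ) 1, extendI w x = profile lam ((1 - h) / 2) u x := fun x hx => by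
    rw [extendI_of_mem hx, hw]
  have hsymm : ∀ x, w (unitInterval.symm x) = w x := fun x => by
    rw [hw, hw, unitInterval.coe_symm_eq, profile_one_sub]
  have hw0 : w 0 = 0 := by
    rw [hw, Set.Icc.coe_zero, profile_of_le hφ ha2 ha.le, hu0]
  refine ⟨⟨⟨hw0, ?_, profileDeriv lam ((1 - h) / 2) u v, continuousOn_profileDeriv ha ht, ?_, ?_⟩,
    fun x => ?_, ?_⟩, hsymm⟩
  · rw [← unitInterval.symm_zero, hsymm, hw0]
  · intro x hx
    refine (hasDerivWithinAt_of_continuousOn_of_off_finite {(1 - h) / 2, 1 - (1 - h) / 2}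
      (continuousOn_profile ha ht) (continuousOn_profileDeriv ha ht) ?_ hx).congr hext
      (hext x hx)
    intro y hy hyS
    simp only [Finset.mem_insert, Finset.mem_singleton, not_or] at hyS
    exact hasDerivAt_profile hφ ha2 ht hW hy hyS.1 hyS.2
  · intro x hx hxa hxb
    rw [hext x (Ioo_subset_Icc_self hx)]
    exact hasDerivAt_profileDeriv hφ hh0 ht hW hnn hx hxa hxb
  · rw [hw]
    exact profile_nonneg hlam ha ha2 hnn x.2
  · intro h0
    have h1 := hext _ ⟨ha.le, (by linarith : (1 - h) / 2 ≤ 1)⟩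
    rw [extendI_of_mem ⟨ha.le, by linarith⟩, h0, profile_of_le hφ ha2 le_rfl] at h1
    exact absurd h1 (hpos _ (right_mem_Ioc.2 ha)).ne

/-! ### Uniqueness and a priori bounds for solutions. -/

section

/-- The data carried by a positive solution, in terms of functions on the real line. -/
structure IsNonnegSol (p h lam : ℝ) (f v : ℝ → ℝ) : Prop where
  contF : ContinuousOn f (Icc 0 1)
  contV : ContinuousOn v (Icc 0 1)
  zero_left : f 0 = 0
  zero_right : f 1 = 0
  derivF : ∀ x ∈ Ioo (0 : ℝ) 1, HasDerivAt f (v x) x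
  derivV : ∀ x ∈ Ioo (0 : ℝ) 1, x ∉ ({(1 - h) / 2, (1 + h) / 2} : Finset ℝ) →
    HasDerivAt v (-(lam * f x + weight h x * f x ^ p)) x
  nonneg : ∀ x ∈ Icc (0 : ℝ) 1, 0 ≤ f x

theorem weight_mem_Icc (h x : ℝ) : weight h x ∈ Icc (0 : ℝ) 1 := by
  unfold weight
  split_ifs <;> simp

theorem weight_of_lt {h x : ℝ} (hx : x ≤ (1 - h) / 2) : weight h x = 1 := by
  unfold weight
  rw [if_neg fun hm => absurd hm.1 (not_lt.2 hx)]

theorem weight_of_mem {h x : ℝ} (hx : x ∈ Ioo ((1 - h) / 2) ((1 + h) / 2)) : weight h x = 0 := by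
  unfold weight
  rw [if_pos hx]

variable {p h lam : ℝ} {f v : ℝ → ℝ}

theorem IsPositiveSolution.exists_isNonnegSol {w : C(unitInterval, ℝ)}
    (hw : IsPositiveSolution p h lam w) : ∃ v : ℝ → ℝ, IsNonnegSol p h lam (extendI w) v ∧
      ∀ x ∈ Icc (0 : ℝ) 1, HasDerivWithinAt (extendI w) (v x) (Icc 0 1) x := by
  obtain ⟨⟨h0, h1, v, hvc, hd, hd2⟩, hnn, -⟩ := hw
  refine ⟨v, ⟨(continuous_extendI w).continuousOn, hvc, ?_, ?_, ?_, ?_, ?_⟩, hd⟩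
  · rw [extendI_of_mem (left_mem_Icc.2 zero_le_one)]; exact h0
  · rw [extendI_of_mem (right_mem_Icc.2 zero_le_one)]; exact h1
  · exact fun x hx => (hd x (Ioo_subset_Icc_self hx)).hasDerivAt (Icc_mem_nhds hx.1 hx.2)
  · intro x hx hxS
    simp only [Finset.mem_insert, Finset.mem_singleton, not_or] at hxS
    exact hd2 x hx hxS.1 hxS.2
  · intro x hx
    rw [extendI_of_mem hx]
    exact hnn _

theorem IsNonnegSol.isTraj (hs : IsNonnegSol p h lam f v) (hh0 : 0 < h) (hh1 : h < 1) :
    IsTraj p lam 0 ((1 - h) / 2) f v where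
  contU := hs.contF.mono (Icc_subset_Icc_right (by linarith))
  contV := hs.contV.mono (Icc_subset_Icc_right (by linarith))
  derivU x hx := hs.derivF x ⟨hx.1, by linarith [hx.2]⟩
  derivV x hx := by
    have hx' : x ∈ Ioo (0 : ℝ) 1 := ⟨hx.1, by linarith [hx.2]⟩
    have := hs.derivV x hx' (by
      simp only [Finset.mem_insert, Finset.mem_singleton, not_or]
      exact ⟨hx.2.ne, by linarith [hx.2] |> ne_of_lt⟩)
    rwa [weight_of_lt hx.2.le, one_mul,
      ← force_of_nonneg (hs.nonneg x (Ioo_subset_Icc_self hx'))] at this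

theorem isNonnegSol_zero (hp : 1 < p) : IsNonnegSol p h lam (fun _ => 0) (fun _ => 0) where
  contF := continuousOn_const
  contV := continuousOn_const
  zero_left := rfl
  zero_right := rfl
  derivF x _ := hasDerivAt_const x 0
  derivV x _ _ := by
    rw [Real.zero_rpow (by linarith)]
    simpa using hasDerivAt_const x (0 : ℝ)
  nonneg _ _ := le_rfl

/-- Grönwall across the jumps of the weight; `0 ≤ weight ≤ 1` and the bounds on both solutions
supply the Lipschitz constant. -/
theorem IsNonnegSol.eq_of_slope_eq {f₁ v₁ f₂ v₂ : ℝ → ℝ} (hp : 1 < p)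
    (h₁ : IsNonnegSol p h lam f₁ v₁) (h₂ : IsNonnegSol p h lam f₂ v₂) (hv : v₁ 0 = v₂ 0)
    {x : ℝ} (hx : x ∈ Icc (0 : ℝ) 1) : f₁ x = f₂ x := by
  obtain ⟨B₁, hB₁⟩ := isCompact_Icc.exists_bound_of_continuousOn h₁.contF
  obtain ⟨B₂, hB₂⟩ := isCompact_Icc.exists_bound_of_continuousOn h₂.contF
  set B := max B₁ B₂
  have hb₁ : ∀ x ∈ Icc (0 : ℝ) 1, f₁ x ≤ B := fun x hx =>
    (le_abs_self _).trans ((hB₁ x hx).trans (le_max_left _ _))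
  have hb₂ : ∀ x ∈ Icc (0 : ℝ) 1, f₂ x ≤ B := fun x hx =>
    (le_abs_self _).trans ((hB₂ x hx).trans (le_max_right _ _))
  have hB : 0 ≤ B := (h₁.nonneg x hx).trans (hb₁ x hx)
  have hpB : 0 ≤ p * B ^ (p - 1) := mul_nonneg (by linarith) (Real.rpow_nonneg hB _)
  have := sq_add_sq_sub_le {(1 - h) / 2, (1 + h) / 2} (L := |lam| + p * B ^ (p - 1)) (D := 0)
    (by positivity) h₁.contF h₁.contV h₂.contF h₂.contV h₁.derivF h₂.derivF h₁.derivV h₂.derivV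
    (fun y hy _ => by
      have hy' := Ioo_subset_Icc_self hy
      have hr := abs_rpow_sub_rpow_le hp (h₁.nonneg y hy') (hb₁ y hy') (h₂.nonneg y hy')
        (hb₂ y hy')
      have hw := weight_mem_Icc h y
      have e : -(lam * f₁ y + weight h y * f₁ y ^ p) - -(lam * f₂ y + weight h y * f₂ y ^ p) =
          -(lam * (f₁ y - f₂ y) + weight h y * (f₁ y ^ p - f₂ y ^ p)) := by ring
      rw [e, abs_neg, add_zero, add_mul]
      refine (abs_add_le _ _).trans (add_le_add (abs_mul _ _).le ?_)
      rw [abs_mul, abs_of_nonneg hw.1]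
      exact (mul_le_of_le_one_left (abs_nonneg _) hw.2).trans hr) hx
  simp only [h₁.zero_left, h₂.zero_left, hv, sub_self, ne_eq, OfNat.ofNat_ne_zero,
    not_false_eq_true, zero_pow, add_zero, zero_mul] at this
  nlinarith [sq_nonneg (f₁ x - f₂ x), sq_nonneg (v₁ x - v₂ x)]

theorem IsNonnegSol.slope_pos (hp : 1 < p) (hs : IsNonnegSol p h lam f v)
    (hne : ∃ x ∈ Icc (0 : ℝ) 1, f x ≠ 0) : 0 < v 0 := by
  rcases lt_trichotomy (v 0) 0 with hlt | h0 | hgt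
  · obtain ⟨d, hd, hneg⟩ := exists_pos_right hs.contV.neg le_rfl zero_lt_one (neg_pos.2 hlt)
    have := lt_of_hasDerivAt_pos (f := fun x => -f x) (f' := fun x => -v x) hd.1
      (hs.contF.mono (Icc_subset_Icc_right hd.2)).neg
      (fun x hx => (hs.derivF x ⟨hx.1, hx.2.trans_le hd.2⟩).fun_neg)
      (fun x hx => hneg x (Ioo_subset_Icc_self hx))
    have h1 := hs.nonneg d ⟨hd.1.le, hd.2⟩
    rw [hs.zero_left] at this
    linarith
  · obtain ⟨x, hx, hfx⟩ := hne
    exact absurd (hs.eq_of_slope_eq hp (isNonnegSol_zero hp) h0 hx) hfx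
  · exact hgt

/-- A first zero would be crossed with negative slope, against nonnegativity just after it. -/
theorem IsNonnegSol.pos_left (hp : 1 < p) (hh0 : 0 < h) (hh1 : h < 1)
    (hs : IsNonnegSol p h lam f v) (hv : 0 < v 0) : ∀ x ∈ Ioc 0 ((1 - h) / 2), 0 < f x := by
  rcases (hs.isTraj hh0 hh1).pos_or_exists_zero hp (by linarith) hs.zero_left hv with
    hpos | ⟨c, hc, -, hfc, hvc⟩
  · exact hpos
  have hc1 : c < 1 := by linarith [hc.2]
  obtain ⟨d, hd, hneg⟩ := exists_pos_right hs.contV.neg hc.1.le hc1 (neg_pos.2 hvc)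
  have := lt_of_hasDerivAt_pos (f := fun x => -f x) (f' := fun x => -v x) hd.1
    (hs.contF.mono (Icc_subset_Icc hc.1.le hd.2)).neg
    (fun x hx => (hs.derivF x ⟨hc.1.trans hx.1, hx.2.trans_le hd.2⟩).fun_neg)
    (fun x hx => hneg x (Ioo_subset_Icc_self hx))
  have h1 := hs.nonneg d ⟨hc.1.le.trans hd.1.le, hd.2⟩
  linarith

theorem lt_of_hasDerivAt_nonneg_off_finite_of_pos {W W' : ℝ → ℝ} {a : ℝ} (S : Finset ℝ)
    (ha0 : 0 < a) (ha1 : a < 1) (hc : ContinuousOn W (Icc 0 1))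
    (hd : ∀ x ∈ Ioo (0 : ℝ) 1, x ∉ S → HasDerivAt W (W' x) x)
    (hnn : ∀ x ∈ Ioo (0 : ℝ) 1, x ∉ S → 0 ≤ W' x) (hS : ∀ x ∈ Ioo 0 a, x ∉ S)
    (hpos : ∀ x ∈ Ioo 0 a, 0 < W' x) : W 0 < W 1 := by
  have h1 := lt_of_hasDerivAt_pos ha0 (hc.mono (Icc_subset_Icc_right ha1.le))
    (fun x hx => hd x ⟨hx.1, hx.2.trans ha1⟩ (hS x hx)) hpos
  exact h1.trans_le (monotoneOn_of_hasDerivAt_nonneg_off_finite S hc hd hnn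
    ⟨ha0.le, ha1.le⟩ (right_mem_Icc.2 zero_le_one) ha1.le)

/-- Testing the equation against the first eigenfunction `sin (π x)`. -/
theorem IsNonnegSol.lt_pi_sq_and_le_rpow (hp : 1 < p) (hh0 : 0 < h) (hh1 : h < 1)
    (hs : IsNonnegSol p h lam f v) (hne : ∃ x ∈ Icc (0 : ℝ) 1, f x ≠ 0) :
    lam < Real.pi ^ 2 ∧
      ∀ M, (∀ x ∈ Icc (0 : ℝ) 1, f x ≤ M) → Real.pi ^ 2 - lam ≤ M ^ (p - 1) := by
  have hpos := hs.pos_left hp hh0 hh1 (hs.slope_pos hp hne)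
  have ha : 0 < (1 - h) / 2 := by linarith
  have ha1 : (1 - h) / 2 < 1 := by linarith
  set S : Finset ℝ := {(1 - h) / 2, (1 + h) / 2}
  have hS : ∀ x ∈ Ioo 0 ((1 - h) / 2), x ∉ S := by
    intro x hx
    simp only [S, Finset.mem_insert, Finset.mem_singleton, not_or]
    exact ⟨hx.2.ne, by linarith [hx.2] |> ne_of_lt⟩
  set W := modeWronskian (Real.pi ^ 2) f v with hWdef
  have hWc : ContinuousOn W (Icc 0 1) :=
    (hs.contV.mul (continuous_mode_right _).continuousOn).sub
      (hs.contF.mul (continuous_modeDeriv_right _).continuousOn)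
  have hWd : ∀ x ∈ Ioo (0 : ℝ) 1, x ∉ S → HasDerivAt W
      ((Real.pi ^ 2 - lam - weight h x * f x ^ (p - 1)) * (f x * mode (Real.pi ^ 2) x)) x := by
    intro x hx hxS
    refine (((hs.derivV x hx hxS).fun_mul (hasDerivAt_mode _ x)).fun_sub
      ((hs.derivF x hx).fun_mul (hasDerivAt_modeDeriv _ x))).congr_deriv ?_
    rw [rpow_eq_rpow_sub_one_mul hp (hs.nonneg x (Ioo_subset_Icc_self hx))]
    ring
  have hW0 : W 0 = 0 := by simp [hWdef, modeWronskian, hs.zero_left, mode_pi_sq_zero]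
  have hW1 : W 1 = 0 := by simp [hWdef, modeWronskian, hs.zero_right, mode_pi_sq_one]
  have hfφ : ∀ x ∈ Ioo (0 : ℝ) 1, 0 ≤ f x * mode (Real.pi ^ 2) x := fun x hx =>
    mul_nonneg (hs.nonneg x (Ioo_subset_Icc_self hx)) (mode_pos le_rfl hx.1 hx.2).le
  have hfφ' : ∀ x ∈ Ioo 0 ((1 - h) / 2), 0 < f x * mode (Real.pi ^ 2) x := fun x hx =>
    mul_pos (hpos x (Ioo_subset_Ioc_self hx)) (mode_pos le_rfl hx.1 (hx.2.trans ha1))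
  -- `W` vanishes at both ends, so `W'` cannot keep one sign. It would be nonpositive if `π² ≤ lam`,
  -- and nonnegative if `M ^ (p - 1) < π² - lam`, strictly on the left outer interval in both cases.
  constructor
  · by_contra! hlam
    have := lt_of_hasDerivAt_nonneg_off_finite_of_pos (W := fun x => -W x) S ha ha1 hWc.neg
      (fun x hx hxS => (hWd x hx hxS).fun_neg)
      (fun x hx _ => by
        have := mul_nonneg (weight_mem_Icc h x).1
          (Real.rpow_nonneg (hs.nonneg x (Ioo_subset_Icc_self hx)) (p - 1))
        have := mul_nonneg (by linarith : 0 ≤ -(Real.pi ^ 2 - lam - weight h x * f x ^ (p - 1)))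
          (hfφ x hx)
        linarith) hS
      (fun x hx => by
        have h1 := Real.rpow_pos_of_pos (hpos x (Ioo_subset_Ioc_self hx)) (p - 1)
        rw [weight_of_lt hx.2.le, one_mul, ← neg_mul]
        exact mul_pos (by linarith) (hfφ' x hx))
    linarith
  · intro M hM
    by_contra! hlt
    have hfM : ∀ x ∈ Icc (0 : ℝ) 1, weight h x * f x ^ (p - 1) ≤ M ^ (p - 1) := by
      intro x hx
      have h1 := Real.rpow_nonneg (hs.nonneg x hx) (p - 1)
      exact (mul_le_of_le_one_left h1 (weight_mem_Icc h x).2).trans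
        (Real.rpow_le_rpow (hs.nonneg x hx) (hM x hx) (by linarith))
    have := lt_of_hasDerivAt_nonneg_off_finite_of_pos (W := W) S ha ha1 hWc hWd
      (fun x hx _ => mul_nonneg (by linarith [hfM x (Ioo_subset_Icc_self hx)]) (hfφ x hx)) hS
      (fun x hx => mul_pos (by linarith [hfM x ⟨hx.1.le, (hx.2.trans ha1).le⟩]) (hfφ' x hx))
    linarith

theorem IsPositiveSolution.exists_ne_zero {w : C(unitInterval, ℝ)}
    (hw : IsPositiveSolution p h lam w) : ∃ x ∈ Icc (0 : ℝ) 1, extendI w x ≠ 0 := by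
  by_contra! h0
  refine hw.2.2 (ContinuousMap.ext fun x => ?_)
  rw [← extendI_of_mem x.2, h0 _ x.2]
  rfl

theorem IsPositiveSolution.lt_pi_sq {w : C(unitInterval, ℝ)} (hp : 1 < p) (hh0 : 0 < h)
    (hh1 : h < 1) (hw : IsPositiveSolution p h lam w) : lam < Real.pi ^ 2 := by
  obtain ⟨v, hv, -⟩ := hw.exists_isNonnegSol
  exact (hv.lt_pi_sq_and_le_rpow hp hh0 hh1 hw.exists_ne_zero).1

theorem IsPositiveSolution.le_norm_rpow {w : C(unitInterval, ℝ)} (hp : 1 < p) (hh0 : 0 < h)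
    (hh1 : h < 1) (hw : IsPositiveSolution p h lam w) : Real.pi ^ 2 - lam ≤ ‖w‖ ^ (p - 1) := by
  obtain ⟨v, hv, -⟩ := hw.exists_isNonnegSol
  refine (hv.lt_pi_sq_and_le_rpow hp hh0 hh1 hw.exists_ne_zero).2 _ fun x hx => ?_
  rw [extendI_of_mem hx]
  exact (le_abs_self _).trans (w.norm_coe_le_norm _)

theorem IsNonnegSol.deriv_half_eq_zero (hs : IsNonnegSol p h lam f v)
    (hsymm : ∀ x ∈ Icc (0 : ℝ) 1, f (1 - x) = f x) : v (1 / 2) = 0 := by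
  have h1 := hs.derivF (1 / 2) (by norm_num)
  have h2 : HasDerivAt (fun x => f (1 - x)) (-v (1 / 2)) (1 / 2) :=
    HasDerivAt.comp_const_sub 1 (1 / 2) (by norm_num at h1 ⊢; exact h1)
  have h3 : HasDerivAt f (-v (1 / 2)) (1 / 2) := by
    refine h2.congr_of_eventuallyEq ?_
    filter_upwards [Icc_mem_nhds (by norm_num : (0 : ℝ) < 1 / 2) (by norm_num : (1 / 2 : ℝ) < 1)]
      with x hx using (hsymm x hx).symm
  linarith [h1.unique h3]

/-- In the gap both functions solve the same linear equation, so the Wronskian is constant there; at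
`1 / 2` both derivatives vanish by symmetry. -/
theorem IsNonnegSol.modeWronskian_eq_zero (hh0 : 0 < h) (hh1 : h < 1)
    (hs : IsNonnegSol p h lam f v) (hsymm : ∀ x ∈ Icc (0 : ℝ) 1, f (1 - x) = f x) :
    modeWronskian lam f v ((1 - h) / 2) = 0 := by
  have ha : (1 - h) / 2 ≤ 1 / 2 := by linarith
  have hsub : Icc ((1 - h) / 2) (1 / 2) ⊆ Icc (0 : ℝ) 1 :=
    Icc_subset_Icc (by linarith) (by norm_num)
  have hc : ContinuousOn (modeWronskian lam f v) (Icc ((1 - h) / 2) (1 / 2)) :=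
    ((hs.contV.mono hsub).mul (continuous_mode_right _).continuousOn).sub
      ((hs.contF.mono hsub).mul (continuous_modeDeriv_right _).continuousOn)
  have hd : ∀ x ∈ Ioo ((1 - h) / 2) (1 / 2), HasDerivAt (modeWronskian lam f v) 0 x := by
    intro x hx
    have hx' : x ∈ Ioo (0 : ℝ) 1 := ⟨by linarith [hx.1], by linarith [hx.2]⟩
    have hxS : x ∉ ({(1 - h) / 2, (1 + h) / 2} : Finset ℝ) := by
      simp only [Finset.mem_insert, Finset.mem_singleton, not_or]
      exact ⟨hx.1.ne', by linarith [hx.2] |> ne_of_lt⟩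
    refine (((hs.derivV x hx' hxS).fun_mul (hasDerivAt_mode _ x)).fun_sub
      ((hs.derivF x hx').fun_mul (hasDerivAt_modeDeriv _ x))).congr_deriv ?_
    rw [weight_of_mem ⟨hx.1, by linarith [hx.2]⟩]
    ring
  have h1 := antitoneOn_of_hasDerivAt_nonpos_off_finite ∅ hc (fun x hx _ => hd x hx)
    (fun _ _ _ => le_rfl) (left_mem_Icc.2 ha) (right_mem_Icc.2 ha) ha
  have h2 := monotoneOn_of_hasDerivAt_nonneg_off_finite ∅ hc (fun x hx _ => hd x hx)
    (fun _ _ _ => le_rfl) (left_mem_Icc.2 ha) (right_mem_Icc.2 ha) ha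
  have h3 : modeWronskian lam f v (1 / 2) = 0 := by
    simp only [modeWronskian, modeDeriv_half, hs.deriv_half_eq_zero hsymm, zero_mul, mul_zero,
      sub_zero]
  linarith

theorem IsSymmetricPositiveSolution.extendI_one_sub {w : C(unitInterval, ℝ)}
    (hw : IsSymmetricPositiveSolution p h lam w) :
    ∀ x ∈ Icc (0 : ℝ) 1, extendI w (1 - x) = extendI w x := by
  intro x hx
  rw [extendI_of_mem hx, extendI_of_mem (x := 1 - x) ⟨by linarith [hx.2], by linarith [hx.1]⟩,
    ← hw.2 ⟨x, hx⟩]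
  rfl

theorem IsSymmetricPositiveSolution.unique {w₁ w₂ : C(unitInterval, ℝ)} (hp : 1 < p) (hh0 : 0 < h)
    (hh1 : h < 1) (h₁ : IsSymmetricPositiveSolution p h lam w₁)
    (h₂ : IsSymmetricPositiveSolution p h lam w₂) : w₁ = w₂ := by
  obtain ⟨v₁, hv₁, -⟩ := h₁.1.exists_isNonnegSol
  obtain ⟨v₂, hv₂, -⟩ := h₂.1.exists_isNonnegSol
  have hv := (hv₁.isTraj hh0 hh1).slope_unique_of_modeWronskian hp (by linarith) (by linarith)
    (h₁.1.lt_pi_sq hp hh0 hh1).le (hv₂.isTraj hh0 hh1) hv₁.zero_left hv₂.zero_left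
    (hv₁.slope_pos hp h₁.1.exists_ne_zero) (hv₂.slope_pos hp h₂.1.exists_ne_zero)
    (hv₁.modeWronskian_eq_zero hh0 hh1 h₁.extendI_one_sub)
    (hv₂.modeWronskian_eq_zero hh0 hh1 h₂.extendI_one_sub)
  ext x
  rw [← extendI_of_mem x.2, ← extendI_of_mem x.2]
  exact hv₁.eq_of_slope_eq hp hv₂ hv x.2

/-- The derivative vanishes at `1 / 2`, and the equation bounds the second derivative by the
right-hand side. -/
theorem IsSymmetricPositiveSolution.abs_derivI_le {w : C(unitInterval, ℝ)} (hp : 1 < p)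
    (hw : IsSymmetricPositiveSolution p h lam w) {x : ℝ} (hx : x ∈ Icc (0 : ℝ) 1) :
    |derivI w x| ≤ |lam| * ‖w‖ + ‖w‖ ^ p := by
  obtain ⟨v, hv, hd⟩ := hw.1.exists_isNonnegSol
  set C := |lam| * ‖w‖ + ‖w‖ ^ p
  have hC0 : 0 ≤ C := by positivity
  have hC : ∀ y ∈ Ioo (0 : ℝ) 1, |lam * extendI w y + weight h y * extendI w y ^ p| ≤ C := by
    intro y hy
    have hy' := Ioo_subset_Icc_self hy
    have h0 := hv.nonneg y hy'
    have hM : extendI w y ≤ ‖w‖ := by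
      rw [extendI_of_mem hy']
      exact (le_abs_self _).trans (w.norm_coe_le_norm _)
    have hr := Real.rpow_nonneg h0 p
    refine (abs_add_le _ _).trans ?_
    rw [abs_mul, abs_of_nonneg h0, abs_of_nonneg (mul_nonneg (weight_mem_Icc h y).1 hr)]
    exact add_le_add (mul_le_mul_of_nonneg_left hM (abs_nonneg _))
      ((mul_le_of_le_one_left hr (weight_mem_Icc h y).2).trans
        (Real.rpow_le_rpow h0 hM (by linarith)))
  have hanti : AntitoneOn (fun y => v y - C * y) (Icc 0 1) :=
    antitoneOn_of_hasDerivAt_nonpos_off_finite _ (hv.contV.sub (by fun_prop))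
      (fun y hy hyS => (hv.derivV y hy hyS).fun_sub
        (by simpa using (hasDerivAt_id y).const_mul C : HasDerivAt (fun y => C * y) C y))
      (fun y hy _ => by linarith [(abs_le.1 (hC y hy)).1])
  have hmono : MonotoneOn (fun y => v y + C * y) (Icc 0 1) :=
    monotoneOn_of_hasDerivAt_nonneg_off_finite _ (hv.contV.add (by fun_prop))
      (fun y hy hyS => (hv.derivV y hy hyS).fun_add
        (by simpa using (hasDerivAt_id y).const_mul C : HasDerivAt (fun y => C * y) C y))
      (fun y hy _ => by linarith [(abs_le.1 (hC y hy)).2])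
  have hhalf : (1 / 2 : ℝ) ∈ Icc (0 : ℝ) 1 := by norm_num
  have hv0 := hv.deriv_half_eq_zero hw.extendI_one_sub
  have e : derivI w x = v x := (hd x hx).derivWithin (uniqueDiffOn_Icc zero_lt_one x hx)
  rw [e, abs_le]
  rcases le_total x (1 / 2) with hle | hle
  · have h1 := hanti hx hhalf hle
    have h2 := hmono hx hhalf hle
    simp only [hv0] at h1 h2
    constructor <;> nlinarith [hx.1]
  · have h1 := hanti hhalf hx hle
    have h2 := hmono hhalf hx hle
    simp only [hv0] at h1 h2
    constructor <;> nlinarith [hx.2]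

end

/-! ### The continuous branch and its closure. -/

theorem exists_branch {p h : ℝ} (hp : 1 < p) (hh0 : 0 < h) (hh1 : h < 1) :
    ∃ U : ℝ → C(unitInterval, ℝ), ContinuousOn U (Iic (Real.pi ^ 2)) ∧ U (Real.pi ^ 2) = 0 ∧
      ∀ lam < Real.pi ^ 2, IsSymmetricPositiveSolution p h lam (U lam) := by
  set a := (1 - h) / 2 with ha_def
  have ha : 0 < a := by rw [ha_def]; linarith
  have ha2 : a ≤ 1 / 2 := by rw [ha_def]; linarith
  obtain ⟨X, Y, hX⟩ := exists_shooting hp ha ha2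
  obtain ⟨σ, hσc, hσ0, hσ⟩ := hX.exists_slope hp ha ha2
  have hjoint : ContinuousOn (fun q : ℝ × unitInterval => profile q.1 a (X q.1 (σ q.1)) q.2)
      (Iic (Real.pi ^ 2) ×ˢ univ) := by
    refine ContinuousOn.mul ?_ (ContinuousOn.div ?_ ?_ ?_)
    · have h1 : ContinuousOn (fun q : ℝ × unitInterval =>
          (q.1, σ q.1, min (min (q.2 : ℝ) (1 - q.2)) a)) (Iic (Real.pi ^ 2) ×ˢ univ) := by
        refine continuousOn_fst.prodMk ((hσc.comp continuousOn_fst fun q hq => hq.1).prodMk ?_)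
        fun_prop
      refine (continuous_fst.comp_continuousOn (hX.continuousOn hp)).comp h1 fun q _ => ?_
      exact ⟨le_min (le_min q.2.2.1 (by linarith [q.2.2.2])) ha.le, min_le_right _ _⟩
    · have hc : Continuous fun q : ℝ × unitInterval => (q.1, max (min (q.2 : ℝ) (1 - q.2)) a) := by
        fun_prop
      exact (continuous_mode.comp hc).continuousOn
    · have hc : Continuous fun q : ℝ × unitInterval => (q.1, a) := by fun_prop
      exact (continuous_mode.comp hc).continuousOn
    · exact fun q hq => (mode_pos hq.1 ha (by linarith)).ne'
  have hcont : ∀ lam ≤ Real.pi ^ 2, Continuous fun x : unitInterval =>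
      profile lam a (X lam (σ lam)) x := by
    intro lam hlam
    exact hjoint.comp_continuous (Continuous.prodMk_right lam) fun x => ⟨hlam, mem_univ _⟩
  have hex : ∀ lam : ℝ, ∃ w : C(unitInterval, ℝ), lam ≤ Real.pi ^ 2 →
      ∀ x : unitInterval, w x = profile lam a (X lam (σ lam)) x := by
    intro lam
    by_cases hlam : lam ≤ Real.pi ^ 2
    · exact ⟨⟨_, hcont lam hlam⟩, fun _ _ => rfl⟩
    · exact ⟨0, fun h => absurd h hlam⟩
  choose U hU using hex
  refine ⟨U, ?_, ?_, fun lam hlam => ?_⟩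
  -- Joint continuity in `(lam, x)` curries to continuity in the sup norm.
  · rw [continuousOn_iff_continuous_domRestrict]
    refine ContinuousMap.continuous_of_continuous_uncurry _ ?_
    have hc : Continuous fun q : Iic (Real.pi ^ 2) × unitInterval => ((q.1 : ℝ), q.2) := by fun_prop
    refine (hjoint.comp_continuous hc fun q => ⟨q.1.2, mem_univ _⟩).congr fun q => ?_
    exact (hU q.1 q.1.2 q.2).symm
  · ext x
    have h0 : X (Real.pi ^ 2) 0 (min (min (x : ℝ) (1 - x)) a) = 0 := by
      have := (hX.traj (Real.pi ^ 2) 0).eq_of_eq_left hp (isTraj_affine (c := 0) hp le_rfl)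
        (by simp [hX.zero_left]) (hX.deriv_left _ 0)
        (x := min (min (x : ℝ) (1 - x)) a)
        ⟨le_min (le_min x.2.1 (by linarith [x.2.2])) ha.le, min_le_right _ _⟩
      exact this.1.trans (zero_mul _)
    rw [hU _ le_rfl, hσ0, profile, h0, zero_mul]
    rfl
  · obtain ⟨hs, hW⟩ := hσ lam hlam
    have hs' : 0 < Y lam (σ lam) 0 := by rwa [hX.deriv_left]
    have hpos : ∀ x ∈ Ioc 0 a, 0 < X lam (σ lam) x := by
      rcases (hX.traj lam (σ lam)).pos_or_modeWronskian_neg hp ha ha2 hlam.le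
        (hX.zero_left _ _) hs' with hpos | hneg
      · exact hpos
      · exact absurd hW hneg.1.ne
    exact isSymmetricPositiveSolution_of_profile hh0 hh1 hlam.le (hX.traj lam (σ lam))
      (hX.zero_left _ _) hpos hW (hU lam hlam.le)

/-- Composing `U` with `min · b` extends it continuously to the line, which exhibits the graph over
`Iic b` as a closed set. -/
theorem closure_graph_Iio {E : Type*} [TopologicalSpace E] [T2Space E] {U : ℝ → E} {b : ℝ}
    (hU : ContinuousOn U (Iic b)) :
    closure ((fun lam => (lam, U lam)) '' Iio b) = (fun lam => (lam, U lam)) '' Iic b := by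
  refine Subset.antisymm (closure_minimal (image_mono Iio_subset_Iic_self) ?_) ?_
  · have hV : Continuous fun lam => U (min lam b) :=
      hU.comp_continuous (by fun_prop) fun lam => mem_Iic.2 (min_le_right _ _)
    have e : (fun lam => (lam, U lam)) '' Iic b =
        {q : ℝ × E | q.1 ≤ b} ∩ {q | q.2 = U (min q.1 b)} := by
      ext ⟨lam, w⟩
      constructor
      · rintro ⟨mu, hmu, hq⟩
        obtain ⟨rfl, rfl⟩ := Prod.mk.inj hq
        exact ⟨hmu, by simp [min_eq_left (mem_Iic.1 hmu)]⟩
      · rintro ⟨hle, hw⟩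
        refine ⟨lam, hle, ?_⟩
        simp only [mem_ofPred_eq] at hle hw
        rw [hw, min_eq_left hle]
    rw [e]
    exact (isClosed_le continuous_fst continuous_const).inter
      (isClosed_eq continuous_snd (hV.comp continuous_fst))
  · rw [← closure_Iio]
    refine ContinuousOn.image_closure ?_
    rw [closure_Iio]
    exact continuousOn_id.prodMk hU

end MooreNehari

theorem theorem2p2 (p h : ℝ) (hp : 1 < p) (hh0 : 0 < h) (hh1 : h < 1) :
    -- the component emanates from `(π², 0)` and projects onto `(-∞, π²]`
    (Real.pi ^ 2, (0 : C(unitInterval, ℝ))) ∈ MooreNehari.symmetricComponent p h ∧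
    Prod.fst '' MooreNehari.symmetricComponent p h = Iic (Real.pi ^ 2) ∧
    -- (a)
    (∀ lam : ℝ, ∀ u : C(unitInterval, ℝ), (lam, u) ∈ MooreNehari.symmetricComponent p h →
      (lam = Real.pi ^ 2 ∧ u = 0) ∨
      (lam < Real.pi ^ 2 ∧ MooreNehari.IsSymmetricPositiveSolution p h lam u ∧
        ∀ w, MooreNehari.IsSymmetricPositiveSolution p h lam w → w = u)) ∧
    -- the family `U lam = u_lam`: the unique symmetric positive solutions, and `0` at `π²`
    (∃ U : ℝ → C(unitInterval, ℝ),
      (∀ lam < Real.pi ^ 2, MooreNehari.IsSymmetricPositiveSolution p h lam (U lam) ∧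
        ∀ w, MooreNehari.IsSymmetricPositiveSolution p h lam w → w = U lam) ∧
      U (Real.pi ^ 2) = 0 ∧
      -- (b)
      (∀ σ ≤ Real.pi ^ 2,
        Tendsto (fun lam => ‖U lam‖) (𝓝[Iio (Real.pi ^ 2) \ {σ}] σ) (𝓝 0) ↔ σ = Real.pi ^ 2) ∧
      -- (c)
      (∀ lam₀ < Real.pi ^ 2, ∃ M : ℝ, ∀ lam ∈ Ico lam₀ (Real.pi ^ 2),
        ‖U lam‖ ≤ M ∧ ∀ x ∈ Icc (0 : ℝ) 1, |MooreNehari.derivI (U lam) x| ≤ M) ∧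
      Tendsto (fun lam => ‖U lam‖) atBot atTop ∧
      -- (d)
      ContinuousOn U (Iic (Real.pi ^ 2)) ∧
      MooreNehari.symmetricComponent p h = (fun lam => (lam, U lam)) '' Iic (Real.pi ^ 2)) ∧
    -- inclusion in the component of all positive solutions
    MooreNehari.symmetricComponent p h ⊆ MooreNehari.component p h := by
  obtain ⟨U, hUc, hU0, hUs⟩ := MooreNehari.exists_branch hp hh0 hh1
  have huniq : ∀ lam < Real.pi ^ 2, ∀ w,
      MooreNehari.IsSymmetricPositiveSolution p h lam w → w = U lam :=
    fun lam hlam w hw => hw.unique hp hh0 hh1 (hUs lam hlam)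
  have hset : {q : ℝ × C(unitInterval, ℝ) |
      MooreNehari.IsSymmetricPositiveSolution p h q.1 q.2} =
      (fun lam => (lam, U lam)) '' Iio (Real.pi ^ 2) := by
    ext ⟨lam, w⟩
    constructor
    · intro hw
      have hlam := hw.1.lt_pi_sq hp hh0 hh1
      exact ⟨lam, hlam, by rw [huniq lam hlam w hw]⟩
    · rintro ⟨mu, hmu, hq⟩
      obtain ⟨rfl, rfl⟩ := Prod.mk.inj hq
      exact hUs _ hmu
  have hmem : (Real.pi ^ 2, (0 : C(unitInterval, ℝ))) ∈
      (fun lam => (lam, U lam)) '' Iic (Real.pi ^ 2) :=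
    ⟨Real.pi ^ 2, self_mem_Iic, by simp only [hU0]⟩
  have hconn : IsPreconnected ((fun lam => (lam, U lam)) '' Iic (Real.pi ^ 2)) :=
    isPreconnected_Iic.image _ (continuousOn_id.prodMk hUc)
  have hcomp : MooreNehari.symmetricComponent p h =
      (fun lam => (lam, U lam)) '' Iic (Real.pi ^ 2) := by
    unfold MooreNehari.symmetricComponent
    rw [hset, MooreNehari.closure_graph_Iio hUc]
    exact hconn.connectedComponentIn hmem
  have hne : ∀ lam < Real.pi ^ 2, U lam ≠ 0 := fun lam hlam => (hUs lam hlam).1.2.2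
  refine ⟨by rwa [hcomp], ?_, ?_, ⟨U, fun lam hlam => ⟨hUs lam hlam, huniq lam hlam⟩, hU0, ?_, ?_,
    ?_, hUc, hcomp⟩, ?_⟩
  · rw [hcomp, image_image, image_id']
  · intro lam u hu
    rw [hcomp] at hu
    obtain ⟨mu, hmu, hq⟩ := hu
    obtain ⟨rfl, rfl⟩ := Prod.mk.inj hq
    rcases (mem_Iic.1 hmu).lt_or_eq with hlt | rfl
    · exact Or.inr ⟨hlt, hUs _ hlt, huniq _ hlt⟩
    · exact Or.inl ⟨rfl, hU0⟩
  · intro σ hσ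
    have hlim : Tendsto (fun lam => ‖U lam‖) (𝓝[Iio (Real.pi ^ 2) \ {σ}] σ) (𝓝 ‖U σ‖) :=
      ((hUc σ hσ).norm.tendsto).mono_left
        (nhdsWithin_mono _ (sdiff_subset.trans Iio_subset_Iic_self))
    constructor
    · intro h0
      by_contra hne'
      have hlt := lt_of_le_of_ne hσ hne'
      -- For `σ < π²` the filter is the punctured neighbourhood filter of `σ`, so the limit `‖U σ‖ ≠
      -- 0` is unique.
      have : (𝓝[Iio (Real.pi ^ 2) \ {σ}] σ).NeBot := by
        rw [Set.sdiff_eq, inter_comm,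
          nhdsWithin_inter_of_mem' (mem_nhdsWithin_of_mem_nhds (Iio_mem_nhds hlt))]
        infer_instance
      exact hne σ hlt (norm_eq_zero.1 (tendsto_nhds_unique hlim h0))
    · rintro rfl
      simpa [hU0] using hlim
  · intro lam₀ _
    obtain ⟨M, hM⟩ := isCompact_Icc.exists_bound_of_continuousOn
      (hUc.mono (Icc_subset_Iic_self : Icc lam₀ (Real.pi ^ 2) ⊆ _))
    obtain ⟨Λ, hΛ⟩ := isCompact_Icc.exists_bound_of_continuousOn
      (continuousOn_id : ContinuousOn id (Icc lam₀ (Real.pi ^ 2)))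
    refine ⟨max M (Λ * M + M ^ p), fun lam hlam => ⟨?_, fun x hx => ?_⟩⟩
    · exact (hM lam (Ico_subset_Icc_self hlam)).trans (le_max_left _ _)
    · have h1 := hM lam (Ico_subset_Icc_self hlam)
      have h2 : |lam| ≤ Λ := hΛ lam (Ico_subset_Icc_self hlam)
      refine ((hUs lam hlam.2).abs_derivI_le hp hx).trans (le_trans ?_ (le_max_right _ _))
      exact add_le_add (mul_le_mul h2 h1 (norm_nonneg _) ((abs_nonneg _).trans h2))
        (Real.rpow_le_rpow (norm_nonneg _) h1 (by linarith))
  · refine tendsto_atTop.2 fun b => ?_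
    filter_upwards [Iio_mem_atBot (Real.pi ^ 2 - |b| ^ (p - 1)), Iio_mem_atBot (Real.pi ^ 2)]
      with lam h1 h2
    have h3 := (hUs lam h2).1.le_norm_rpow hp hh0 hh1
    -- A norm below `b` would violate `π² - lam ≤ ‖U lam‖ ^ (p - 1)`.
    by_contra! hlt
    have h4 : ‖U lam‖ ^ (p - 1) ≤ |b| ^ (p - 1) :=
      Real.rpow_le_rpow (norm_nonneg _) (hlt.le.trans (le_abs_self b)) (by linarith)
    have h1' : lam < Real.pi ^ 2 - |b| ^ (p - 1) := h1
    linarith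
  · exact connectedComponentIn_mono _ (closure_mono fun q hq => hq.1)
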